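/- Let $p\neq q$ be primes, let $s_p(q)$ denote the multiplicative order of $p$ modulo $q$, and assume $p\mid s_p(q)$. Put $m=p^{s_p(q)/p}$, $$G=\langle \alpha,\beta \mid \alpha^p=\beta^q=1,\ \alpha\beta\alpha^{-1}=\beta^m\rangle ,\qquad N=\langle\beta\rangle ,\qquad Q=\mathbb F_pN .$$ Let $Q=Q_0\oplus Q_1\oplus\dots\oplus Q_s$ be the decomposition of the semisimple commutative algebra $Q$ into its minimal ideals, where $Q_0$ is the ideal generated by $1+\beta+\dots+\beta^{q-1}$. For $1\le i\le s$ let $R_i=Q_i\oplus\alpha Q_i\oplus\dots\oplus\alpha^{p-1}Q_i\subseteq \mathbb F_pG$. Then each $R_i$ with $1\le i\le s$ contains exactly $$1+p^{s_p(q)/p}+p^{2s_p(q)/p}+\dots+p^{(p-1)s_p(q)/p}$$ minimal left ideals of $\mathbb F_pG$. Choose a left ideal $I=\bigoplus_{i=1}^s I_i$ of $\mathbb F_pG$ at random, where the $I_i$ are chosen independently, each $I_i$ uniformly among the minimal left ideals of $\mathbb F_pG$ contained in $R_i$. Let $$h_p(x)=-(1-x)\log_p(1-x)-x\log_p\Bigl(\frac{x}{p-1}\Bigr)$$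 be the $p$-ary entropy function. If $0<\delta\le\frac{p-1}{p}$ and $$h_p(\delta)\le\frac{p-1}{p^2}-\frac{\log_p(q)}{p\cdot s_p(q)},$$ then the probability that the relative minimum distance of $I$ (the minimum Hamming distance between distinct elements of $I$, with respect to the basis $G$ of $\mathbb F_pG$, divided by $|G|=pq$) is less than $\delta$ is at most $$p^{-p\,s_p(q)\left(\frac{p-1}{p^2}-h_p(\delta)\right)+(2p+1)\log_p(q)} .$$ -/

import Mathlib

namespace GroupCode

/-- The relators of `⟨α, β | α ^ p = β ^ q = 1, α β α⁻¹ = β ^ m⟩`, in the free group on two letters;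
the letter `0` is `α` and the letter `1` is `β`. -/
def metacyclicRels (p q m : ℕ) : Set (FreeGroup (Fin 2)) :=
  {FreeGroup.of 0 ^ p, FreeGroup.of 1 ^ q,
    FreeGroup.of 0 * FreeGroup.of 1 * (FreeGroup.of 0)⁻¹ * (FreeGroup.of 1 ^ m)⁻¹}

/-- The group `⟨α, β | α ^ p = β ^ q = 1, α β α⁻¹ = β ^ m⟩`. -/
abbrev Metacyclic (p q m : ℕ) : Type := PresentedGroup (metacyclicRels p q m)

/-- The generator `α`. -/
def gα (p q m : ℕ) : Metacyclic p q m := PresentedGroup.of 0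

/-- The generator `β`. -/
def gβ (p q m : ℕ) : Metacyclic p q m := PresentedGroup.of 1

/-- The multiplicative order of `p` modulo `q`. -/
noncomputable def ordMod (p q : ℕ) : ℕ := orderOf (p : ZMod q)

/-- The group `⟨α, β | α ^ p = β ^ q = 1, α β α⁻¹ = β ^ m⟩` with `m = p ^ (s / p)`,
where `s` is the order of `p` modulo `q`. -/
abbrev G (p q : ℕ) : Type := Metacyclic p q (p ^ (ordMod p q / p))

/-- The generator `α` of `G p q`. -/
noncomputable def α (p q : ℕ) : G p q := gα p q _

/-- The generator `β` of `G p q`. -/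
noncomputable def β (p q : ℕ) : G p q := gβ p q _

/-- The group algebra `𝔽_p G`. -/
abbrev R (p q : ℕ) : Type := MonoidAlgebra (ZMod p) (G p q)

/-- The subgroup `N = ⟨β⟩`. -/
noncomputable abbrev N (p q : ℕ) : Subgroup (G p q) := Subgroup.zpowers (β p q)

/-- The group algebra `Q = 𝔽_p N`. -/
abbrev Q (p q : ℕ) : Type := MonoidAlgebra (ZMod p) (N p q)

/-- The inclusion of `𝔽_p N` in `𝔽_p G`. -/
noncomputable def incl (p q : ℕ) : Q p q →ₐ[ZMod p] R p q :=
  MonoidAlgebra.mapDomainAlgHom (ZMod p) (ZMod p) (N p q).subtype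

/-- The ideal of `Q` generated by `1 + β + ⋯ + β ^ (q - 1)`. -/
noncomputable def Q₀ (p q : ℕ) : Ideal (Q p q) :=
  Ideal.span {∑ i ∈ Finset.range q,
    MonoidAlgebra.of (ZMod p) (N p q) (⟨β p q, Subgroup.mem_zpowers (β p q)⟩ ^ i)}

/-- The index set of the nontrivial blocks: the simple summands `Q₁, …, Qₛ` of the semisimple
algebra `Q` other than `Q₀`, that is, the minimal ideals of `Q` different from `Q₀`. -/
abbrev Idx (p q : ℕ) : Type := {J : Ideal (Q p q) // IsAtom J ∧ J ≠ Q₀ p q}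

/-- The block `J + α J + ⋯ + α ^ (p - 1) J` of `𝔽_p G` attached to an ideal `J` of `Q`. -/
noncomputable def block (p q : ℕ) (J : Ideal (Q p q)) : Submodule (ZMod p) (R p q) :=
  ⨆ k : Fin p, ((J.restrictScalars (ZMod p)).map (incl p q).toLinearMap).map
    (LinearMap.mulLeft (ZMod p) (MonoidAlgebra.of (ZMod p) (G p q) (α p q ^ (k : ℕ))))

/-- The minimal left ideals of `𝔽_p G` that lie in the block attached to `J`
(for noncommutative rings, `Ideal` means left ideal). -/
abbrev MinLeft (p q : ℕ) (J : Ideal (Q p q)) : Type :=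
  {I : Ideal (R p q) // IsAtom I ∧ ∀ x ∈ I, x ∈ block p q J}

/-- The sample space: one minimal left ideal `I_i` of each nontrivial block. The uniform
distribution on this product is the independent choice of uniform `I_i`. -/
abbrev Choice (p q : ℕ) : Type := ∀ J : Idx p q, MinLeft p q J.1

/-- The left ideal `I = ⨁ I_i`. -/
noncomputable def code {p q : ℕ} (c : Choice p q) : Ideal (R p q) := ⨆ J : Idx p q, (c J).1

/-- The Hamming distance of two elements of the group algebra. -/
noncomputable def hdist {p q : ℕ} (x y : R p q) : ℕ := Set.ncard {g : G p q | x.coeff g ≠ y.coeff g}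

/-- The minimum distance of a group code. -/
noncomputable def minDist {p q : ℕ} (I : Ideal (R p q)) : ℕ :=
  sInf {d | ∃ x ∈ I, ∃ y ∈ I, x ≠ y ∧ hdist x y = d}

/-- The relative minimum distance of a group code: its minimum distance over its length. -/
noncomputable def relMinDist {p q : ℕ} (I : Ideal (R p q)) : ℝ :=
  (minDist I : ℝ) / (Nat.card (G p q) : ℝ)

/-- The `p`-ary entropy function. -/
noncomputable def entropy (p : ℕ) (x : ℝ) : ℝ :=
  -(1 - x) * Real.logb p (1 - x) - x * Real.logb p (x / ((p : ℝ) - 1))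

/-- The probability of an event under the uniform distribution on a finite nonempty type. -/
noncomputable def uniformProb (Ω : Type) (E : Set Ω) : ℝ :=
  (Nat.card E : ℝ) / (Nat.card Ω : ℝ)

end GroupCode

/-!
Write `s` for the order of `p` modulo `q` and `t = s / p`.

*Counting minimal left ideals.* Every element `z` of `Q = 𝔽_p N` satisfies `z ^ p ^ s = z`, and
conjugation by `α` acts on `Q` as `z ↦ z ^ p ^ t` (`pow_p_pow_ordMod`, `α_mul_incl`). Hence a
minimal ideal `J` has an identity `e`, which is central in `𝔽_p G`, so that the block of `J` is
`𝔽_p G e`; and for `J ≠ Q₀` the ideal `J` is a field with `p ^ s` elements, because `β` acts on it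
as a primitive `q`-th root of unity (`IsIdentity.card_quotient`). Since `(α - 1) ^ p = 0`, every
minimal left ideal contains nonzero `α`-fixed elements. Conversely the nonzero `α`-fixed elements
of the block are `(1 + α + ⋯ + α ^ (p - 1)) z` with `0 ≠ z ∈ J`, each of them generates a minimal
left ideal, and those in a given minimal left ideal form one orbit under the nonzero elements of
the subfield with `p ^ t` elements (`IsIdentity.card_fiber`). So there are
`(p ^ s - 1) / (p ^ t - 1)` minimal left ideals in the block.

*The random code.* A word with nonzero components exactly in the blocks of a set `S` determines
the chosen minimal left ideals in these blocks, since distinct minimal left ideals are disjoint; it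
therefore lies in the random code with probability at most `p ^ (-|S| (p - 1) t)`. The sum of the
blocks of `S` is invariant under left translation and has dimension at most `|S| p s`, so it has at
most `p ^ (|S| p s h(δ))` words of relative weight at most `δ` (`ncard_lowWeight_mul_le`; for
translation-invariant codes every translate of an information set is an information set, and a
low-weight word is sparse on an average translate). With `a = p ^ (-p s ((p - 1) / p ^ 2 - h(δ)))`
the union bound over the nonempty sets `S` gives `(1 + a) ^ l - 1`, where `l ≤ q` is the number of
blocks; the hypothesis on `h(δ)` says `a ≤ 1 / q`, so this is at most `2 q a`.
-/

set_option linter.unusedSectionVars false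

namespace GroupCode

/-! ### The group -/

section Group

variable {p q : ℕ}

lemma α_pow : α p q ^ p = 1 :=
  PresentedGroup.one_of_mem (rels := metacyclicRels p q (p ^ (ordMod p q / p)))
    (x := FreeGroup.of 0 ^ p) (by simp [metacyclicRels])

lemma β_pow : β p q ^ q = 1 :=
  PresentedGroup.one_of_mem (rels := metacyclicRels p q (p ^ (ordMod p q / p)))
    (x := FreeGroup.of 1 ^ q) (by simp [metacyclicRels])

lemma α_mul_β : α p q * β p q = β p q ^ p ^ (ordMod p q / p) * α p q := by
  have h : α p q * β p q * (α p q)⁻¹ * (β p q ^ p ^ (ordMod p q / p))⁻¹ = 1 :=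
    PresentedGroup.one_of_mem (rels := metacyclicRels p q (p ^ (ordMod p q / p)))
      (x := FreeGroup.of 0 * FreeGroup.of 1 * (FreeGroup.of 0)⁻¹ *
        (FreeGroup.of 1 ^ (p ^ (ordMod p q / p)))⁻¹) (by simp [metacyclicRels])
  rw [mul_inv_eq_one, mul_inv_eq_iff_eq_mul] at h
  exact h

lemma N_pow {n : G p q} (hn : n ∈ N p q) : n ^ q = 1 := by
  obtain ⟨k, rfl⟩ := Subgroup.mem_zpowers_iff.1 hn
  rw [← zpow_natCast, ← zpow_mul, mul_comm, zpow_mul, zpow_natCast, β_pow, one_zpow]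

lemma α_mul_N {n : G p q} (hn : n ∈ N p q) :
    α p q * n = n ^ p ^ (ordMod p q / p) * α p q := by
  obtain ⟨k, rfl⟩ := Subgroup.mem_zpowers_iff.1 hn
  have h : SemiconjBy (α p q) (β p q) (β p q ^ p ^ (ordMod p q / p)) := α_mul_β
  have h2 := h.zpow_right k
  rw [SemiconjBy, ← zpow_natCast, ← zpow_mul, mul_comm (_ : ℤ) k, zpow_mul] at h2
  rwa [zpow_natCast] at h2

/-- Normal form: every element of `G` is `n * α ^ k` with `n ∈ N` and `k ∈ ℕ`. -/
lemma exists_eq_mul_α_pow (hp : p ≠ 0) (g : G p q) :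
    ∃ n ∈ N p q, ∃ k : ℕ, g = n * α p q ^ k := by
  -- `N` is stable under conjugation by the nonnegative powers of `α`.
  have conj : ∀ k : ℕ, ∀ n ∈ N p q, ∃ n' ∈ N p q, α p q ^ k * n = n' * α p q ^ k := by
    intro k
    induction k with
    | zero => intro n hn; exact ⟨n, hn, by simp⟩
    | succ k ih =>
      intro n hn
      obtain ⟨n', hn', h⟩ := ih _ ((N p q).pow_mem hn (p ^ (ordMod p q / p)))
      exact ⟨n', hn', by rw [pow_succ, mul_assoc, α_mul_N hn, ← mul_assoc, h, mul_assoc]⟩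
  obtain ⟨w, rfl⟩ := PresentedGroup.mk_surjective _ g
  induction w using FreeGroup.induction_on with
  | C1 => exact ⟨1, one_mem _, 0, by simp⟩
  | of i =>
    fin_cases i
    · exact ⟨1, one_mem _, 1, by simp [α, gα, PresentedGroup.of]⟩
    · exact ⟨β p q, Subgroup.mem_zpowers _, 0, by simp [β, gβ, PresentedGroup.of]⟩
  | inv_of i _ =>
    fin_cases i
    · refine ⟨1, one_mem _, p - 1, ?_⟩
      rw [map_inv, one_mul, inv_eq_iff_mul_eq_one]
      change α p q * α p q ^ (p - 1) = 1
      rw [← pow_succ', Nat.sub_add_cancel (Nat.one_le_iff_ne_zero.2 hp), α_pow]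
    · exact ⟨(β p q)⁻¹, inv_mem (Subgroup.mem_zpowers _), 0, by simp [β, gβ, PresentedGroup.of]⟩
  | mul x y hx hy =>
    obtain ⟨n, hn, k, h⟩ := hx
    obtain ⟨n', hn', k', h'⟩ := hy
    obtain ⟨n'', hn'', h''⟩ := conj k n' hn'
    refine ⟨n * n'', mul_mem hn hn'', k + k', ?_⟩
    rw [map_mul, h, h', pow_add, mul_assoc, ← mul_assoc (_ ^ k), h'']
    simp only [mul_assoc]

lemma exists_eq_α_pow_mul (hp : p ≠ 0) (g : G p q) :
    ∃ k < p, ∃ n ∈ N p q, g = α p q ^ k * n := by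
  obtain ⟨n, hn, k, h⟩ := exists_eq_mul_α_pow hp g⁻¹
  refine ⟨(k * (p - 1)) % p, Nat.mod_lt _ (Nat.pos_of_ne_zero hp), n⁻¹, inv_mem hn, ?_⟩
  rw [← pow_eq_pow_mod _ α_pow, ← inv_inv g, h, mul_inv_rev, mul_left_inj, inv_eq_iff_mul_eq_one,
    ← pow_add, ← mul_one_add, Nat.add_sub_cancel' (Nat.one_le_iff_ne_zero.2 hp), mul_comm, pow_mul,
    α_pow, one_pow]

lemma finite_N (hq : q ≠ 0) : Finite (N p q) := by
  have : IsOfFinOrder (β p q) := isOfFinOrder_iff_pow_eq_one.2 ⟨q, Nat.pos_of_ne_zero hq, β_pow⟩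
  exact Finite.of_equiv _ (finEquivZPowers this)

lemma finite_G (hp : p ≠ 0) (hq : q ≠ 0) : Finite (G p q) := by
  have := finite_N (p := p) hq
  refine Finite.of_surjective (fun x : Fin p × N p q => α p q ^ (x.1 : ℕ) * x.2) fun g => ?_
  obtain ⟨k, hk, n, hn, rfl⟩ := exists_eq_α_pow_mul hp g
  exact ⟨(⟨k, hk⟩, ⟨n, hn⟩), rfl⟩

/-- The homomorphism `α ↦ 1`, `β ↦ 0` to `ℤ/p` shows that `1, α, …, α ^ (p - 1)` lie in
different cosets of `N`. -/
lemma dvd_of_α_pow_mem_N {k : ℤ} (h : α p q ^ k ∈ N p q) : (p : ℤ) ∣ k := by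
  let f : Fin 2 → Multiplicative (ZMod p) := ![Multiplicative.ofAdd 1, 1]
  have hf : ∀ r ∈ metacyclicRels p q (p ^ (ordMod p q / p)), FreeGroup.lift f r = 1 := by
    rintro r (rfl | rfl | rfl)
    · simp [f, ← ofAdd_nsmul]
    · simp [f]
    · simp [f]
  let F := PresentedGroup.toGroup hf
  have h0 : F (α p q) = Multiplicative.ofAdd 1 := PresentedGroup.toGroup.of hf
  have h1 : F (β p q) = 1 := PresentedGroup.toGroup.of hf
  obtain ⟨j, hj⟩ := Subgroup.mem_zpowers_iff.1 h
  have := congrArg F hj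
  rw [map_zpow, map_zpow, h0, h1, one_zpow, ← ofAdd_zsmul, eq_comm, ofAdd_eq_one] at this
  simpa [ZMod.intCast_zmod_eq_zero_iff_dvd] using this

variable [Fact p.Prime] [Fact q.Prime]

lemma cast_ne_zero (hpq : p ≠ q) : (p : ZMod q) ≠ 0 := by
  rw [Ne, ZMod.natCast_eq_zero_iff, Nat.prime_dvd_prime_iff_eq Fact.out Fact.out]
  exact hpq.symm

lemma cast_pow_ordMod : (p : ZMod q) ^ ordMod p q = 1 := pow_orderOf_eq_one _

lemma ordMod_pos (hpq : p ≠ q) : 0 < ordMod p q := by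
  rw [ordMod, orderOf_pos_iff, isOfFinOrder_iff_pow_eq_one]
  exact ⟨q - 1, Nat.sub_pos_of_lt (Fact.out : q.Prime).one_lt,
    ZMod.pow_card_sub_one_eq_one (cast_ne_zero hpq)⟩

lemma N_pow_pow_ordMod {n : G p q} (hn : n ∈ N p q) : n ^ p ^ ordMod p q = n := by
  have h : p ^ ordMod p q ≡ 1 [MOD q] := by
    rw [← ZMod.natCast_eq_natCast_iff]
    simpa using cast_pow_ordMod (p := p) (q := q)
  have h2 := pow_eq_pow_mod (p ^ ordMod p q) (N_pow hn)
  rw [h2, h, ← pow_eq_pow_mod 1 (N_pow hn), pow_one]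

/-- The action of `G` on `ℤ/q` by `α x = m x`, `β x = x + 1` shows that `β` is nontrivial. -/
lemma β_ne_one (hpq : p ≠ q) (hdvd : p ∣ ordMod p q) : β p q ≠ 1 := by
  let a : Equiv.Perm (ZMod q) :=
    Equiv.mulLeft₀ ((p : ZMod q) ^ (ordMod p q / p)) (pow_ne_zero _ (cast_ne_zero hpq))
  let b : Equiv.Perm (ZMod q) := Equiv.addRight 1
  have ha : ∀ (k : ℕ) (x : ZMod q), (a ^ k) x = ((p : ZMod q) ^ (ordMod p q / p)) ^ k * x := by
    intro k
    induction k with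
    | zero => simp
    | succ k ih => intro x; rw [pow_succ, Equiv.Perm.mul_apply, ih, pow_succ, mul_assoc]; rfl
  have hb : ∀ (k : ℕ) (x : ZMod q), (b ^ k) x = x + k := by
    intro k
    induction k with
    | zero => simp
    | succ k ih =>
      intro x
      rw [pow_succ, Equiv.Perm.mul_apply, ih]
      simp only [b, Equiv.coe_addRight]
      push_cast; ring
  let f : Fin 2 → Equiv.Perm (ZMod q) := ![a, b]
  have hf : ∀ r ∈ metacyclicRels p q (p ^ (ordMod p q / p)), FreeGroup.lift f r = 1 := by
    rintro r (rfl | rfl | rfl)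
    · ext1 x
      simp [f, ha, ← pow_mul, Nat.div_mul_cancel hdvd, cast_pow_ordMod]
    · ext1 x
      simp [f, hb]
    · simp only [map_mul, map_inv, map_pow, FreeGroup.lift_apply_of, f]
      rw [mul_inv_eq_one, mul_inv_eq_iff_eq_mul]
      ext1 x
      simp only [Matrix.cons_val_zero, Matrix.cons_val_one, Equiv.Perm.mul_apply, hb]
      simp [a, b, mul_add]
  intro h
  have h1 : PresentedGroup.toGroup hf (β p q) = b := PresentedGroup.toGroup.of hf
  rw [h, map_one] at h1
  have := congrArg (fun σ : Equiv.Perm (ZMod q) => σ 0) h1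
  simp [b] at this

end Group

/-! ### The commutative algebra `𝔽_p N` and its minimal ideals -/

section Commutative

variable {p q : ℕ}

noncomputable instance : CommGroup (N p q) :=
  { (inferInstance : Group (N p q)) with
    mul_comm := fun a b => by
      obtain ⟨i, hi⟩ := Subgroup.mem_zpowers_iff.1 a.2
      obtain ⟨j, hj⟩ := Subgroup.mem_zpowers_iff.1 b.2
      exact Subtype.ext (by simp only [Subgroup.coe_mul, ← hi, ← hj, zpow_mul_comm]) }

/-- The generator `β` as an element of `𝔽_p N`. -/
noncomputable def βQ (p q : ℕ) : Q p q :=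
  MonoidAlgebra.of (ZMod p) (N p q) ⟨β p q, Subgroup.mem_zpowers (β p q)⟩

lemma βQ_pow : βQ p q ^ q = 1 := by
  rw [βQ, ← map_pow, ← map_one (MonoidAlgebra.of (ZMod p) (N p q))]
  congr 1
  exact Subtype.ext β_pow

/-- The sum `1 + β + ⋯ + β ^ (q - 1)`, which generates `Q₀`. -/
noncomputable def sumβ (p q : ℕ) : Q p q := ∑ i ∈ Finset.range q, βQ p q ^ i

lemma Q₀_eq : Q₀ p q = Ideal.span {sumβ p q} := by
  simp only [Q₀, sumβ, βQ, map_pow]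

variable [Fact p.Prime] [Fact q.Prime]

instance : Finite (N p q) := finite_N (Fact.out : q.Prime).ne_zero

instance : Finite (G p q) := finite_G (Fact.out : p.Prime).ne_zero (Fact.out : q.Prime).ne_zero

instance : Finite (Q p q) :=
  Finite.of_equiv (N p q → ZMod p)
    (MonoidAlgebra.coeffEquiv.trans Finsupp.equivFunOnFinite).symm

instance : Finite (R p q) :=
  Finite.of_equiv (G p q → ZMod p)
    (MonoidAlgebra.coeffEquiv.trans Finsupp.equivFunOnFinite).symm

instance : CharP (Q p q) p :=
  charP_of_injective_algebraMap (FaithfulSMul.algebraMap_injective (ZMod p) (Q p q)) p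

instance : CharP (R p q) p :=
  charP_of_injective_algebraMap (FaithfulSMul.algebraMap_injective (ZMod p) (R p q)) p

lemma single_pow_p_pow (k : ℕ) (n : N p q) (c : ZMod p) :
    (MonoidAlgebra.single n c : Q p q) ^ p ^ k = MonoidAlgebra.single (n ^ p ^ k) c := by
  rw [MonoidAlgebra.single_pow, ZMod.pow_card_pow]

/-- `z ↦ z ^ p ^ s` is an `𝔽_p`-algebra endomorphism of `𝔽_p N` that fixes `β`. -/
lemma pow_p_pow_ordMod (z : Q p q) : z ^ p ^ ordMod p q = z := by
  induction z using MonoidAlgebra.induction_linear with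
  | zero => exact zero_pow (pow_ne_zero _ (Fact.out : p.Prime).ne_zero)
  | add x y hx hy => rw [add_pow_char_pow x y p, hx, hy]
  | single n c =>
    rw [single_pow_p_pow]
    congr 1
    exact Subtype.ext (N_pow_pow_ordMod n.2)

/-- The element `e` is an identity element of the ideal `J`. -/
structure IsIdentity (J : Ideal (Q p q)) (e : Q p q) : Prop where
  mem : e ∈ J
  mul_eq : ∀ z ∈ J, z * e = z

lemma one_lt_p_pow_ordMod (hpq : p ≠ q) : 1 < p ^ ordMod p q :=
  Nat.one_lt_pow (ordMod_pos hpq).ne' (Fact.out : p.Prime).one_lt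

variable {J : Ideal (Q p q)} {e : Q p q}

lemma eq_span_of_isAtom (hJ : IsAtom J) {z : Q p q} (hz : z ∈ J) (hz0 : z ≠ 0) :
    J = Ideal.span {z} := by
  refine ((hJ.le_iff.1 ((Ideal.span_singleton_le_iff_mem _).2 hz)).resolve_left ?_).symm
  exact mt Ideal.span_singleton_eq_bot.1 hz0

/-- In a minimal ideal, the power `z ^ (p ^ s - 1)` of any nonzero element is an identity. -/
lemma exists_isIdentity (hpq : p ≠ q) (hJ : IsAtom J) : ∃ e, IsIdentity J e := by
  obtain ⟨z, hz, hz0⟩ := (Submodule.ne_bot_iff _).1 hJ.1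
  have hs := one_lt_p_pow_ordMod hpq
  refine ⟨z ^ (p ^ ordMod p q - 1), J.pow_mem_of_mem hz _ (by omega), fun y hy => ?_⟩
  rw [eq_span_of_isAtom hJ hz hz0, Ideal.mem_span_singleton'] at hy
  obtain ⟨a, rfl⟩ := hy
  rw [mul_assoc, ← pow_succ', Nat.sub_add_cancel hs.le, pow_p_pow_ordMod]

lemma IsIdentity.ne_zero (hJ : IsAtom J) (he : IsIdentity J e) : e ≠ 0 := by
  rintro rfl
  refine hJ.1 ((Submodule.eq_bot_iff _).2 fun z hz => ?_)
  rw [← he.2 z hz, mul_zero]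

lemma IsIdentity.mem_annihilator (he : IsIdentity J e) {w : Q p q} :
    w ∈ J.annihilator ↔ w * e = 0 := by
  refine ⟨fun h => Submodule.mem_annihilator.1 h e he.1, fun h => ?_⟩
  refine Submodule.mem_annihilator.2 fun z hz => ?_
  rw [smul_eq_mul, ← he.2 z hz, mul_left_comm, h, mul_zero]

/-- Every element of `𝔽_p N` that acts nontrivially on a minimal ideal acts invertibly. -/
lemma IsIdentity.exists_mul_eq (hJ : IsAtom J) (he : IsIdentity J e) {w : Q p q}
    (hw : w * e ≠ 0) : ∃ v, v * (w * e) = e := by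
  have h := he.1
  rw [eq_span_of_isAtom hJ (J.mul_mem_left w he.1) hw, Ideal.mem_span_singleton'] at h
  exact h

lemma IsIdentity.isMaximal (hJ : IsAtom J) (he : IsIdentity J e) :
    (Submodule.annihilator J : Ideal (Q p q)).IsMaximal := by
  rw [Ideal.isMaximal_iff]
  refine ⟨fun h => he.ne_zero hJ ?_, fun I w hI hw hwI => ?_⟩
  · simpa using he.mem_annihilator.1 h
  · obtain ⟨v, hv⟩ := he.exists_mul_eq hJ (mt he.mem_annihilator.2 hw)
    have h1 : 1 - v * w ∈ I := hI (he.mem_annihilator.2 (by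
      rw [sub_mul, one_mul, mul_assoc, hv, sub_self]))
    simpa using I.add_mem h1 (I.mul_mem_left v hwI)

/-- A minimal ideal is mapped bijectively onto the residue field of its annihilator. -/
lemma IsIdentity.bijective_mk (he : IsIdentity J e) :
    Function.Bijective fun z : J => Ideal.Quotient.mk (Submodule.annihilator J) (z : Q p q) := by
  constructor
  · intro x y h
    have h1 := he.mem_annihilator.1 (Ideal.Quotient.eq.1 h)
    rw [sub_mul, he.2 _ x.2, he.2 _ y.2, sub_eq_zero] at h1
    exact Subtype.ext h1
  · intro y
    obtain ⟨w, rfl⟩ := Ideal.Quotient.mk_surjective y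
    refine ⟨⟨w * e, J.mul_mem_left w he.1⟩, Ideal.Quotient.eq.2 (he.mem_annihilator.2 ?_)⟩
    rw [sub_mul, mul_assoc, he.2 e he.1, sub_self]

lemma βQ_mul_sumβ : βQ p q * sumβ p q = sumβ p q := by
  have h : (βQ p q - 1) * sumβ p q = 0 := by
    rw [sumβ, mul_geom_sum, βQ_pow, sub_self]
  rwa [sub_mul, one_mul, sub_eq_zero] at h

lemma βQ_pow_mul {z : Q p q} (h : βQ p q * z = z) (i : ℕ) : βQ p q ^ i * z = z := by
  induction i with
  | zero => simp
  | succ i ih => rw [pow_succ, mul_assoc, h, ih]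

/-- Every element of `𝔽_p N` acts on the `β`-fixed element `sumβ` through a scalar. -/
lemma exists_smul_sumβ (z : Q p q) : ∃ c : ZMod p, z * sumβ p q = c • sumβ p q := by
  induction z using MonoidAlgebra.induction_linear with
  | zero => exact ⟨0, by simp⟩
  | add x y hx hy =>
    obtain ⟨a, ha⟩ := hx
    obtain ⟨b, hb⟩ := hy
    exact ⟨a + b, by rw [add_mul, ha, hb, add_smul]⟩
  | single n c =>
    have hfin : IsOfFinOrder (β p q) :=
      isOfFinOrder_iff_pow_eq_one.2 ⟨q, (Fact.out : q.Prime).pos, β_pow⟩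
    obtain ⟨k, hk⟩ := hfin.mem_powers_iff_mem_zpowers.2 n.2
    have h : (MonoidAlgebra.single n c : Q p q) = c • βQ p q ^ k := by
      rw [βQ, ← map_pow, MonoidAlgebra.of_apply, MonoidAlgebra.smul_single, smul_eq_mul, mul_one]
      congr 1
      exact Subtype.ext hk.symm
    exact ⟨c, by rw [h, smul_mul_assoc, βQ_pow_mul βQ_mul_sumβ]⟩

lemma cast_q_ne_zero (hpq : p ≠ q) : (q : ZMod p) ≠ 0 := cast_ne_zero hpq.symm

/-- The group element `β` acts nontrivially on every minimal ideal other than `Q₀`. -/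
lemma IsIdentity.βQ_sub_one_mul_ne_zero (hpq : p ≠ q) (hJ : IsAtom J) (hJ0 : J ≠ Q₀ p q)
    (he : IsIdentity J e) : (βQ p q - 1) * e ≠ 0 := by
  intro h
  rw [sub_mul, one_mul, sub_eq_zero] at h
  have h1 : sumβ p q * e = (q : ZMod p) • e := by
    rw [sumβ, Finset.sum_mul, Finset.sum_congr rfl fun i _ => βQ_pow_mul h i]
    simp [Nat.cast_smul_eq_nsmul]
  obtain ⟨c, hc⟩ := exists_smul_sumβ e
  have h2 : e = ((q : ZMod p)⁻¹ * c) • sumβ p q := by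
    rw [mul_smul, ← hc, mul_comm, h1, inv_smul_smul₀ (cast_q_ne_zero hpq)]
  have hc0 : (q : ZMod p)⁻¹ * c ≠ 0 := by
    intro h0
    rw [h0, zero_smul] at h2
    exact he.ne_zero hJ h2
  have h3 : sumβ p q = algebraMap (ZMod p) (Q p q) ((q : ZMod p)⁻¹ * c)⁻¹ * e := by
    rw [← Algebra.smul_def, eq_inv_smul_iff₀ hc0, ← h2]
  have h4 : sumβ p q ≠ 0 := by
    intro h0
    rw [h0, smul_zero] at h2
    exact he.ne_zero hJ h2
  refine hJ0 ((eq_span_of_isAtom hJ ?_ h4).trans Q₀_eq.symm)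
  rw [h3]
  exact J.mul_mem_left _ he.1

/-- The residue field at a nontrivial minimal ideal is generated by a primitive `q`-th root of
unity, so it has `p ^ s` elements. -/
lemma IsIdentity.card_quotient (hpq : p ≠ q) (hJ : IsAtom J) (hJ0 : J ≠ Q₀ p q)
    (he : IsIdentity J e) :
    Nat.card (Q p q ⧸ (Submodule.annihilator J : Ideal (Q p q))) = p ^ ordMod p q := by
  have := he.isMaximal hJ
  let K := Q p q ⧸ (Submodule.annihilator J : Ideal (Q p q))
  let _ : Field K := Ideal.Quotient.field _
  have : Finite K := Finite.of_surjective _ Ideal.Quotient.mk_surjective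
  let _ : Fintype K := Fintype.ofFinite K
  have : CharP K p := charP_of_injective_algebraMap (algebraMap (ZMod p) K).injective p
  obtain ⟨d, -, hd⟩ := FiniteField.card K p
  have hs := one_lt_p_pow_ordMod (p := p) hpq
  -- `x ^ p ^ s = x` on the residue field, whose unit group is cyclic of order `p ^ d - 1`.
  have hle : p ^ (d : ℕ) - 1 ≤ p ^ ordMod p q - 1 := by
    rw [← hd, ← Nat.card_eq_fintype_card, ← Nat.card_units, ← IsCyclic.exponent_eq_card]
    refine Nat.le_of_dvd (by omega) (Monoid.exponent_dvd_of_forall_pow_eq_one fun u => ?_)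
    obtain ⟨z, hz⟩ := Ideal.Quotient.mk_surjective (u : K)
    have h1 : (u : K) ^ p ^ ordMod p q = u := by
      rw [← hz, ← map_pow, pow_p_pow_ordMod]
    refine Units.ext (mul_right_cancel₀ u.ne_zero ?_)
    rw [Units.val_pow_eq_pow_val, ← pow_succ, Nat.sub_add_cancel hs.le, h1, Units.val_one, one_mul]
  -- The image of `β` has order `q`, which therefore divides `p ^ d - 1`.
  have hdvd : ordMod p q ∣ (d : ℕ) := by
    let ζ : K := Ideal.Quotient.mk _ (βQ p q)
    have hζ1 : ζ ≠ 1 := by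
      intro h
      refine he.βQ_sub_one_mul_ne_zero hpq hJ hJ0 (he.mem_annihilator.1 ?_)
      rw [← Ideal.Quotient.eq_zero_iff_mem, map_sub, map_one, sub_eq_zero]
      exact h
    have hζq : orderOf ζ = q := orderOf_eq_prime (by
      rw [← map_pow, βQ_pow, map_one]) hζ1
    have hζ0 : ζ ≠ 0 := by
      intro h
      have := pow_orderOf_eq_one ζ
      rw [hζq, h, zero_pow (Fact.out : q.Prime).ne_zero] at this
      exact zero_ne_one this
    have h1 := orderOf_dvd_of_pow_eq_one (FiniteField.pow_card_sub_one_eq_one ζ hζ0)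
    rw [hζq, hd] at h1
    refine orderOf_dvd_of_pow_eq_one ?_
    have h2 := (Nat.modEq_iff_dvd' (Nat.one_le_pow _ _ (Fact.out : p.Prime).pos)).2 h1
    rw [← ZMod.natCast_eq_natCast_iff] at h2
    simpa using h2.symm
  rw [Nat.card_eq_fintype_card, hd]
  refine le_antisymm ?_ (Nat.pow_le_pow_right (Fact.out : p.Prime).pos (Nat.le_of_dvd d.pos hdvd))
  omega

lemma IsIdentity.card_eq (hpq : p ≠ q) (hJ : IsAtom J) (hJ0 : J ≠ Q₀ p q)
    (he : IsIdentity J e) : Nat.card J = p ^ ordMod p q := by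
  rw [← he.card_quotient hpq hJ hJ0]
  exact Nat.card_congr (Equiv.ofBijective _ he.bijective_mk)

/-- The elements of the residue field fixed by `x ↦ x ^ p ^ (s / p)` form the subfield with
`p ^ (s / p)` elements. -/
lemma IsIdentity.card_units_fixed (hpq : p ≠ q) (hdvd : p ∣ ordMod p q) (hJ : IsAtom J)
    (hJ0 : J ≠ Q₀ p q) (he : IsIdentity J e) :
    Nat.card {u : (Q p q ⧸ (Submodule.annihilator J : Ideal (Q p q)))ˣ //
      u ^ (p ^ (ordMod p q / p) - 1) = 1} = p ^ (ordMod p q / p) - 1 := by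
  have := he.isMaximal hJ
  let K := Q p q ⧸ (Submodule.annihilator J : Ideal (Q p q))
  let _ : Field K := Ideal.Quotient.field _
  have : Finite K := Finite.of_surjective _ Ideal.Quotient.mk_surjective
  have h := IsCyclic.card_powMonoidHom_ker Kˣ (p ^ (ordMod p q / p) - 1)
  have h2 : Nat.card Kˣ = p ^ ordMod p q - 1 := by
    rw [Nat.card_units]; exact congrArg (· - 1) (he.card_quotient hpq hJ hJ0)
  rw [h2, Nat.gcd_eq_right] at h
  · exact h
  · nth_rw 2 [← Nat.div_mul_cancel hdvd]
    rw [pow_mul]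
    exact by simpa only [one_pow] using Nat.sub_dvd_pow_sub_pow _ 1 p
end Commutative

/-! ### The blocks of the group algebra -/

section Blocks

variable {p q : ℕ} [Fact p.Prime] [Fact q.Prime]

/-- The group element `g` in `𝔽_p G`. -/
noncomputable def elt (g : G p q) : R p q := MonoidAlgebra.of (ZMod p) (G p q) g

lemma elt_one : elt (1 : G p q) = 1 := map_one _

lemma elt_mul (g h : G p q) : elt (g * h) = elt g * elt h := map_mul _ _ _

lemma elt_pow (g : G p q) (k : ℕ) : elt (g ^ k) = elt g ^ k := map_pow _ _ _

lemma elt_eq_single (g : G p q) : elt g = MonoidAlgebra.single g 1 := rfl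

lemma coeff_elt_mul (g h : G p q) (x : R p q) : (elt g * x).coeff h = x.coeff (g⁻¹ * h) := by
  rw [elt_eq_single, MonoidAlgebra.coeff_single_mul_apply, one_mul]

lemma coeff_incl (y : Q p q) (n : N p q) : (incl p q y).coeff n = y.coeff n := by
  simp only [incl, MonoidAlgebra.mapDomainAlgHom_apply]
  exact Finsupp.mapDomain_apply Subtype.val_injective _ _

lemma coeff_incl_of_notMem (y : Q p q) {g : G p q} (hg : g ∉ N p q) :
    (incl p q y).coeff g = 0 := by
  simp only [incl, MonoidAlgebra.mapDomainAlgHom_apply]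
  refine Finsupp.mapDomain_of_notMem_range _ _ ?_
  simpa using hg

lemma incl_single (n : N p q) (c : ZMod p) :
    incl p q (MonoidAlgebra.single n c) = MonoidAlgebra.single (n : G p q) c := by
  simp [incl]

lemma incl_of (n : N p q) : incl p q (MonoidAlgebra.of _ _ n) = elt (n : G p q) :=
  incl_single n 1

/-- Conjugation by `α` is the `s / p`-th power of the Frobenius endomorphism of `𝔽_p N`. -/
lemma α_mul_incl (z : Q p q) :
    elt (α p q) * incl p q z = incl p q (z ^ p ^ (ordMod p q / p)) * elt (α p q) := by
  induction z using MonoidAlgebra.induction_linear with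
  | zero => rw [zero_pow (pow_ne_zero _ (Fact.out : p.Prime).ne_zero)]; simp
  | add x y hx hy => rw [add_pow_char_pow x y p, map_add, map_add, mul_add, hx, hy, add_mul]
  | single n c =>
    rw [single_pow_p_pow, incl_single, incl_single, elt_eq_single,
      MonoidAlgebra.single_mul_single, MonoidAlgebra.single_mul_single, mul_comm c]
    congr 1
    exact α_mul_N n.2

/-- The element of `𝔽_p N` formed by the coefficients of `x` on the coset `g N`. -/
noncomputable def comp (g : G p q) : R p q →+ Q p q :=
  MonoidAlgebra.comapDomainAddMonoidHom (fun n : N p q => g * n)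
    fun _ _ h => Subtype.ext (mul_left_cancel h)

lemma coeff_comp (g : G p q) (x : R p q) (n : N p q) : (comp g x).coeff n = x.coeff (g * n) :=
  rfl

lemma comp_elt_mul (g h : G p q) (x : R p q) : comp g (elt h * x) = comp (h⁻¹ * g) x := by
  ext n
  rw [coeff_comp, coeff_elt_mul, coeff_comp, mul_assoc]

lemma comp_mul_incl (g : G p q) (x : R p q) (z : Q p q) :
    comp g (x * incl p q z) = comp g x * z := by
  induction z using MonoidAlgebra.induction_linear with
  | zero => simp
  | add y z hy hz => rw [map_add, mul_add, map_add, hy, hz, mul_add]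
  | single n c =>
    ext n'
    rw [incl_single, coeff_comp, MonoidAlgebra.coeff_mul_single_apply,
      MonoidAlgebra.coeff_mul_single_apply, coeff_comp, mul_assoc]
    rfl

lemma comp_one_incl (y : Q p q) : comp 1 (incl p q y) = y := by
  ext n
  rw [coeff_comp, one_mul, coeff_incl]

lemma comp_incl_of_notMem (y : Q p q) {g : G p q} (hg : g ∉ N p q) : comp g (incl p q y) = 0 := by
  ext n
  rw [coeff_comp, coeff_incl_of_notMem]
  · rfl
  · rwa [Subgroup.mul_mem_cancel_right _ n.2]

lemma α_pow_mem_N {i j : ℕ} (hi : i < p) (hj : j < p)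
    (h : (α p q ^ i)⁻¹ * α p q ^ j ∈ N p q) : i = j := by
  have h1 : (α p q) ^ ((j : ℤ) - i) ∈ N p q := by
    rwa [sub_eq_neg_add, zpow_add, zpow_neg, zpow_natCast, zpow_natCast]
  have h2 := Int.eq_zero_of_abs_lt_dvd (dvd_of_α_pow_mem_N h1) (by rw [abs_lt]; omega)
  omega

/-- Every element of `𝔽_p G` is the sum of its components on the cosets of `N`. -/
lemma sum_elt_mul_incl_comp (x : R p q) :
    ∑ k ∈ Finset.range p, elt (α p q ^ k) * incl p q (comp (α p q ^ k) x) = x := by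
  ext g
  obtain ⟨k, hk, n, hn, rfl⟩ := exists_eq_α_pow_mul (Fact.out : p.Prime).ne_zero g
  rw [MonoidAlgebra.coeff_sum, Finsupp.finsetSum_apply,
    Finset.sum_eq_single_of_mem k (Finset.mem_range.2 hk)]
  · rw [coeff_elt_mul,
      inv_mul_cancel_left, coeff_incl _ ⟨n, hn⟩, coeff_comp]
  · intro j hj hjk
    rw [coeff_elt_mul,
      coeff_incl_of_notMem]
    rw [← mul_assoc, Subgroup.mul_mem_cancel_right _ hn]
    exact fun h => hjk (α_pow_mem_N (Finset.mem_range.1 hj) hk h)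

variable {J : Ideal (Q p q)} {e : Q p q}

lemma elt_mul_incl_mem_block {z : Q p q} (hz : z ∈ J) {k : ℕ} (hk : k < p) :
    elt (α p q ^ k) * incl p q z ∈ block p q J := by
  refine Submodule.mem_iSup_of_mem (⟨k, hk⟩ : Fin p) ?_
  exact Submodule.mem_map_of_mem (f := LinearMap.mulLeft (ZMod p) _)
    (Submodule.mem_map_of_mem (f := (incl p q).toLinearMap) hz)

/-- The block of `J` is the left ideal generated by the identity of `J`. -/
lemma IsIdentity.mem_block_iff (he : IsIdentity J e) {x : R p q} :
    x ∈ block p q J ↔ x * incl p q e = x := by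
  constructor
  · intro hx
    suffices block p q J ≤ LinearMap.eqLocus (LinearMap.mulRight (ZMod p) (incl p q e))
      LinearMap.id from this hx
    refine iSup_le fun k => ?_
    rintro _ ⟨_, ⟨z, hz, rfl⟩, rfl⟩
    change elt (α p q ^ (k : ℕ)) * incl p q z * incl p q e = elt (α p q ^ (k : ℕ)) * incl p q z
    rw [mul_assoc, ← map_mul, he.2 z hz]
  · intro hx
    rw [← sum_elt_mul_incl_comp x, ← hx]
    refine Submodule.sum_mem _ fun k hk => elt_mul_incl_mem_block ?_ (Finset.mem_range.1 hk)
    rw [comp_mul_incl]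
    exact J.mul_mem_left _ he.1

lemma IsIdentity.mul_mem_block (he : IsIdentity J e) (r : R p q) {x : R p q}
    (hx : x ∈ block p q J) : r * x ∈ block p q J := by
  rw [he.mem_block_iff] at hx ⊢
  rw [mul_assoc, hx]

lemma IsIdentity.pow_eq (he : IsIdentity J e) {k : ℕ} (hk : k ≠ 0) : e ^ k = e := by
  have h : IsIdempotentElem e := he.2 e he.1
  exact h.pow_eq hk

/-- The identity of an ideal of `𝔽_p N` is fixed by Frobenius, hence central in `𝔽_p G`. -/
lemma IsIdentity.incl_mul_comm (he : IsIdentity J e) (x : R p q) :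
    incl p q e * x = x * incl p q e := by
  have hα : Commute (incl p q e) (elt (α p q)) := by
    have := α_mul_incl e
    rw [he.pow_eq (pow_ne_zero _ (Fact.out : p.Prime).ne_zero)] at this
    exact this.symm
  have hN : ∀ n ∈ N p q, Commute (incl p q e) (elt n) := fun n hn => by
    rw [← incl_of ⟨n, hn⟩]
    exact (Commute.all _ _).map (incl p q)
  induction x using MonoidAlgebra.induction_linear with
  | zero => simp
  | add x y hx hy => rw [mul_add, hx, hy, add_mul]
  | single g c =>
    obtain ⟨k, -, n, hn, rfl⟩ := exists_eq_α_pow_mul (Fact.out : p.Prime).ne_zero g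
    have h : (MonoidAlgebra.single (α p q ^ k * n) c : R p q) = c • (elt (α p q) ^ k * elt n) := by
      rw [← elt_pow, ← elt_mul, elt_eq_single, MonoidAlgebra.smul_single, smul_eq_mul, mul_one]
    rw [h]
    exact (((hα.pow_right k).mul_right (hN n hn)).smul_right c)

lemma finrank_iSup_le_sum {K V ι : Type*} [Field K] [AddCommGroup V] [Module K V]
    [FiniteDimensional K V] (f : ι → Submodule K V) (s : Finset ι) :
    Module.finrank K (⨆ i ∈ s, f i : Submodule K V) ≤ ∑ i ∈ s, Module.finrank K (f i) := by
  classical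
  induction s using Finset.induction_on with
  | empty => simp
  | insert a s ha ih =>
    rw [Finset.iSup_insert, Finset.sum_insert ha]
    exact (Submodule.finrank_add_le_finrank_add_finrank _ _).trans (Nat.add_le_add_left ih _)

instance : Module.Finite (ZMod p) (Q p q) := Module.Finite.of_finite
instance : Module.Finite (ZMod p) (R p q) := Module.Finite.of_finite

lemma IsIdentity.finrank_block_le (hpq : p ≠ q) (hJ : IsAtom J) (hJ0 : J ≠ Q₀ p q)
    (he : IsIdentity J e) : Module.finrank (ZMod p) (block p q J) ≤ p * ordMod p q := by
  have hJs : Module.finrank (ZMod p) (J.restrictScalars (ZMod p)) = ordMod p q := by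
    have h := he.card_eq hpq hJ hJ0
    have h2 : Nat.card (J.restrictScalars (ZMod p)) = Nat.card J := rfl
    rw [← h2, Module.natCard_eq_pow_finrank (K := ZMod p), Nat.card_zmod] at h
    exact Nat.pow_right_injective (Fact.out : p.Prime).two_le h
  have h := finrank_iSup_le_sum (fun k : Fin p =>
    ((J.restrictScalars (ZMod p)).map (incl p q).toLinearMap).map
    (LinearMap.mulLeft (ZMod p) (MonoidAlgebra.of (ZMod p) (G p q) (α p q ^ (k : ℕ)))))
    Finset.univ
  rw [iSup_congr fun k => iSup_pos (Finset.mem_univ k)] at h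
  refine h.trans ((Finset.sum_le_card_nsmul _ _ (ordMod p q) fun k _ => ?_).trans (by simp))
  exact (Submodule.finrank_map_le _ _).trans ((Submodule.finrank_map_le _ _).trans hJs.le)

end Blocks

/-! ### Minimal left ideals and `α`-fixed elements -/

section MinimalLeftIdeals

variable {p q : ℕ} [Fact p.Prime] [Fact q.Prime] {J : Ideal (Q p q)} {e : Q p q}

/-- Every nonzero left ideal contains a nonzero `α`-fixed element, since
`(α - 1) ^ p = α ^ p - 1 = 0`. -/
lemma exists_fixed {I : Ideal (R p q)} (hI : I ≠ ⊥) :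
    ∃ x ∈ I, elt (α p q) * x = x ∧ x ≠ 0 := by
  obtain ⟨x, hx, hx0⟩ := (Submodule.ne_bot_iff _).1 hI
  have h : (elt (α p q) - 1) ^ p = 0 := by
    rw [sub_pow_char_of_commute p (Commute.one_right (elt (α p q))), ← elt_pow, α_pow, elt_one,
      one_pow, sub_self]
  have hex : ∃ n, (elt (α p q) - 1) ^ n * x = 0 := ⟨p, by rw [h, zero_mul]⟩
  classical
  have h0 : Nat.find hex ≠ 0 := fun h0 => hx0 (by
    have := Nat.find_spec hex
    rwa [h0, pow_zero, one_mul] at this)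
  refine ⟨(elt (α p q) - 1) ^ (Nat.find hex - 1) * x, I.mul_mem_left _ hx, ?_,
    Nat.find_min hex (Nat.sub_one_lt h0)⟩
  rw [← sub_eq_zero, ← sub_one_mul, ← mul_assoc, ← pow_succ',
    Nat.sub_add_cancel (Nat.one_le_iff_ne_zero.2 h0)]
  exact Nat.find_spec hex

lemma elt_α_pow_mul {x : R p q} (hx : elt (α p q) * x = x) (k : ℕ) :
    elt (α p q ^ k) * x = x := by
  rw [elt_pow]
  induction k with
  | zero => simp
  | succ k ih => rw [pow_succ, mul_assoc, hx, ih]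

/-- The left ideal generated by an `α`-fixed element `x` is `Q x`. -/
lemma exists_mul_eq_incl_mul {x : R p q} (hx : elt (α p q) * x = x) (r : R p q) :
    ∃ y, r * x = incl p q y * x := by
  induction r using MonoidAlgebra.induction_linear with
  | zero => exact ⟨0, by simp⟩
  | add r r' hr hr' =>
    obtain ⟨y, hy⟩ := hr
    obtain ⟨y', hy'⟩ := hr'
    exact ⟨y + y', by rw [add_mul, hy, hy', map_add, add_mul]⟩
  | single g c =>
    obtain ⟨n, hn, k, rfl⟩ := exists_eq_mul_α_pow (Fact.out : p.Prime).ne_zero g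
    refine ⟨MonoidAlgebra.single ⟨n, hn⟩ c, ?_⟩
    rw [incl_single]
    nth_rw 2 [← elt_α_pow_mul hx k]
    rw [← mul_assoc, elt_eq_single, MonoidAlgebra.single_mul_single, mul_one]

/-- The `α`-fixed elements of a block correspond to the elements of `J`, through
`z ↦ (1 + α + ⋯ + α ^ (p - 1)) z`. -/
noncomputable def fixedEquiv (he : IsIdentity J e) :
    {x : R p q // x ∈ block p q J ∧ elt (α p q) * x = x} ≃ J where
  toFun x := ⟨comp 1 x.1, by
    rw [← he.mem_block_iff.1 x.2.1, comp_mul_incl]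
    exact J.mul_mem_left _ he.1⟩
  invFun z := ⟨∑ k ∈ Finset.range p, elt (α p q ^ k) * incl p q z.1,
    Submodule.sum_mem _ fun k hk => elt_mul_incl_mem_block z.2 (Finset.mem_range.1 hk), by
    have h : (elt (α p q) - 1) * ∑ k ∈ Finset.range p, elt (α p q ^ k) = 0 := by
      simp only [elt_pow]
      rw [mul_geom_sum, ← elt_pow, α_pow, elt_one, sub_self]
    rw [← Finset.sum_mul, ← sub_eq_zero, ← sub_one_mul, ← mul_assoc, h, zero_mul]⟩
  left_inv x := by
    refine Subtype.ext ((Finset.sum_congr rfl fun k _ => ?_).trans (sum_elt_mul_incl_comp x.1))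
    congr 2
    change comp 1 x.1 = comp (α p q ^ k) x.1
    nth_rw 2 [← elt_α_pow_mul x.2.2 k]
    rw [comp_elt_mul, inv_mul_cancel]
  right_inv z := by
    refine Subtype.ext ?_
    change comp 1 (∑ k ∈ Finset.range p, elt (α p q ^ k) * incl p q z.1) = z.1
    rw [map_sum, Finset.sum_eq_single_of_mem 0 (Finset.mem_range.2 (Fact.out : p.Prime).pos)]
    · rw [pow_zero, elt_one, one_mul, comp_one_incl]
    · intro k hk hk0
      rw [comp_elt_mul, comp_incl_of_notMem]
      intro h
      exact hk0 (α_pow_mem_N (Finset.mem_range.1 hk) (Fact.out : p.Prime).pos (by simpa using h))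

/-- The nonzero `α`-fixed elements of the block of `J`. -/
abbrev FixedNeZero (J : Ideal (Q p q)) : Type :=
  {x : R p q // (x ∈ block p q J ∧ elt (α p q) * x = x) ∧ x ≠ 0}

lemma IsIdentity.card_fixedNeZero (hpq : p ≠ q) (hJ : IsAtom J) (hJ0 : J ≠ Q₀ p q)
    (he : IsIdentity J e) : Nat.card (FixedNeZero J) = p ^ ordMod p q - 1 := by
  have h0 : (0 : R p q) ∈ block p q J ∧ elt (α p q) * 0 = 0 := ⟨Submodule.zero_mem _, mul_zero _⟩
  let S : Set (R p q) := {x | x ∈ block p q J ∧ elt (α p q) * x = x}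
  have hS : S.ncard = p ^ ordMod p q :=
    (Nat.card_congr (fixedEquiv he)).trans (he.card_eq hpq hJ hJ0)
  have h1 : Nat.card (FixedNeZero J) = (S \ {0}).ncard := rfl
  rw [h1, Set.ncard_sdiff_singleton_of_mem (show (0 : R p q) ∈ S from h0), hS]

lemma IsIdentity.incl_mul_of_mem_block (he : IsIdentity J e) {x : R p q} (hx : x ∈ block p q J) :
    incl p q e * x = x := by
  rw [he.incl_mul_comm, he.mem_block_iff.1 hx]

/-- The elements of `𝔽_p N` that kill a nonzero element of the block of `J` are those that
kill `J`. -/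
lemma IsIdentity.incl_mul_eq_zero_iff (hJ : IsAtom J) (he : IsIdentity J e) {x : R p q}
    (hx : x ∈ block p q J) (hx0 : x ≠ 0) {w : Q p q} :
    incl p q w * x = 0 ↔ w ∈ J.annihilator := by
  rw [he.mem_annihilator]
  constructor
  · intro h
    by_contra hw
    obtain ⟨v, hv⟩ := he.exists_mul_eq hJ hw
    apply hx0
    rw [← he.incl_mul_of_mem_block hx, ← hv, map_mul, map_mul, mul_assoc, mul_assoc,
      he.incl_mul_of_mem_block hx, h, mul_zero]
  · intro h
    rw [← he.incl_mul_of_mem_block hx, ← mul_assoc, ← map_mul, h, map_zero, zero_mul]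

/-- A nonzero `α`-fixed element of a block generates a minimal left ideal. -/
lemma IsIdentity.isAtom_span (hJ : IsAtom J) (he : IsIdentity J e) (x : FixedNeZero J) :
    IsAtom (Ideal.span {x.1}) := by
  obtain ⟨x, ⟨hx, hαx⟩, hx0⟩ := x
  refine ⟨mt Ideal.span_singleton_eq_bot.1 hx0, fun I hI => ?_⟩
  by_contra hI0
  obtain ⟨y, hy, hy0⟩ := (Submodule.ne_bot_iff _).1 hI0
  obtain ⟨r, rfl⟩ := Ideal.mem_span_singleton'.1 (hI.le hy)
  obtain ⟨w, hw⟩ := exists_mul_eq_incl_mul hαx r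
  rw [hw] at hy hy0
  rw [Ne, he.incl_mul_eq_zero_iff hJ hx hx0, he.mem_annihilator] at hy0
  obtain ⟨v, hv⟩ := he.exists_mul_eq hJ hy0
  refine hI.not_ge ((Ideal.span_singleton_le_iff_mem _).2 ?_)
  have h : x = incl p q v * (incl p q w * x) := by
    conv_lhs => rw [← he.incl_mul_of_mem_block hx, ← hv, map_mul, map_mul, mul_assoc, mul_assoc,
      he.incl_mul_of_mem_block hx]
  have h' := I.mul_mem_left (incl p q v) hy
  rwa [← h] at h'

/-- The minimal left ideal generated by a nonzero `α`-fixed element of the block of `J`. -/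
noncomputable def IsIdentity.toMinLeft (hJ : IsAtom J) (he : IsIdentity J e) (x : FixedNeZero J) :
    MinLeft p q J :=
  ⟨Ideal.span {x.1}, he.isAtom_span hJ x, fun y hy => by
    obtain ⟨r, rfl⟩ := Ideal.mem_span_singleton'.1 hy
    exact he.mul_mem_block r x.2.1.1⟩

lemma IsIdentity.toMinLeft_eq_iff (hJ : IsAtom J) (he : IsIdentity J e) (x : FixedNeZero J)
    (I : MinLeft p q J) : he.toMinLeft hJ x = I ↔ x.1 ∈ I.1 := by
  constructor
  · rintro rfl
    exact Ideal.subset_span rfl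
  · intro h
    refine Subtype.ext ((I.2.1.le_iff.1 ((Ideal.span_singleton_le_iff_mem _).2 h)).resolve_left ?_)
    exact mt Ideal.span_singleton_eq_bot.1 x.2.2

lemma IsIdentity.toMinLeft_surjective (hJ : IsAtom J) (he : IsIdentity J e) :
    Function.Surjective (he.toMinLeft hJ) := by
  intro I
  obtain ⟨x, hx, hαx, hx0⟩ := exists_fixed I.2.1.1
  exact ⟨⟨x, ⟨I.2.2 x hx, hαx⟩, hx0⟩, (he.toMinLeft_eq_iff hJ _ _).2 hx⟩

lemma pow_pred_eq_one_iff {K : Type*} [Field K] {a : K} (ha : a ≠ 0) {k : ℕ} (hk : 1 ≤ k) :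
    a ^ (k - 1) = 1 ↔ a ^ k = a := by
  nth_rw 2 [← Nat.sub_add_cancel hk]
  rw [pow_succ, mul_eq_right₀ ha]

/-- The `α`-fixed elements of a minimal left ideal form a line over the field with
`p ^ (s / p)` elements. -/
lemma IsIdentity.card_fiber (hpq : p ≠ q) (hdvd : p ∣ ordMod p q) (hJ : IsAtom J)
    (hJ0 : J ≠ Q₀ p q) (he : IsIdentity J e) (I : MinLeft p q J) :
    Nat.card {x : FixedNeZero J // he.toMinLeft hJ x = I} = p ^ (ordMod p q / p) - 1 := by
  rw [← he.card_units_fixed hpq hdvd hJ hJ0]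
  obtain ⟨⟨x, ⟨hx, hαx⟩, hx0⟩, hI⟩ := he.toMinLeft_surjective hJ I
  have hxI : x ∈ I.1 := (he.toMinLeft_eq_iff hJ _ _).1 hI
  have hspan : ∀ y ∈ I.1, ∃ w, y = incl p q w * x := fun y hy => by
    rw [← hI] at hy
    obtain ⟨r, rfl⟩ := Ideal.mem_span_singleton'.1 hy
    exact exists_mul_eq_incl_mul hαx r
  have hmax := he.isMaximal hJ
  let _ : Field (Q p q ⧸ (Submodule.annihilator J : Ideal (Q p q))) := Ideal.Quotient.field _
  have key : ∀ w w' : Q p q, incl p q w * x = incl p q w' * x ↔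
      Ideal.Quotient.mk (Submodule.annihilator J) w =
        Ideal.Quotient.mk (Submodule.annihilator J) w' := fun w w' => by
    rw [Ideal.Quotient.eq, ← he.incl_mul_eq_zero_iff hJ hx hx0, map_sub, sub_mul, sub_eq_zero]
  have key0 : ∀ w : Q p q, incl p q w * x = 0 ↔
      Ideal.Quotient.mk (Submodule.annihilator J) w = 0 := fun w => by
    rw [Ideal.Quotient.eq_zero_iff_mem, he.incl_mul_eq_zero_iff hJ hx hx0]
  have ht : 1 ≤ p ^ (ordMod p q / p) := Nat.one_le_pow _ _ (Fact.out : p.Prime).pos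
  have hα : ∀ w : Q p q, elt (α p q) * (incl p q w * x) =
      incl p q (w ^ p ^ (ordMod p q / p)) * x := fun w => by
    rw [← mul_assoc, α_mul_incl, mul_assoc, hαx]
  have hlift : ∀ u : Q p q ⧸ (Submodule.annihilator J : Ideal (Q p q)),
    Ideal.Quotient.mk (Submodule.annihilator J)
      (Function.surjInv Ideal.Quotient.mk_surjective u) = u :=
    Function.surjInv_eq Ideal.Quotient.mk_surjective
  symm
  refine Nat.card_congr (Equiv.ofBijective (fun u => ⟨⟨incl p q
    (Function.surjInv Ideal.Quotient.mk_surjective u.1.1) * x, ⟨he.mul_mem_block _ hx, ?_⟩, ?_⟩,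
      ?_⟩) ⟨?_, ?_⟩)
  · rw [hα, key, map_pow, hlift]
    have := congrArg Units.val u.2
    rw [Units.val_pow_eq_pow_val, Units.val_one] at this
    exact (pow_pred_eq_one_iff u.1.ne_zero ht).1 this
  · rw [Ne, key0, hlift]
    exact u.1.ne_zero
  · rw [he.toMinLeft_eq_iff]
    exact I.1.mul_mem_left _ hxI
  · intro u u' h
    have h1 := congrArg (fun a => a.1.1) h
    rw [key, hlift, hlift] at h1
    exact Subtype.ext (Units.ext h1)
  · intro y
    have hyI := (he.toMinLeft_eq_iff hJ y.1 I).1 y.2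
    have hw := hspan y.1.1 hyI
    obtain ⟨w, hw⟩ := hw
    have hy0 := y.1.2.2
    have hαy := y.1.2.1.2
    rw [hw, Ne, key0] at hy0
    rw [hw, hα, key, map_pow] at hαy
    refine ⟨⟨Units.mk0 _ hy0, Units.ext ?_⟩, ?_⟩
    · rw [Units.val_pow_eq_pow_val, Units.val_mk0, Units.val_one]
      exact (pow_pred_eq_one_iff hy0 ht).2 hαy
    · refine Subtype.ext (Subtype.ext ?_)
      refine Eq.trans ?_ hw.symm
      rw [key, hlift]
      rfl

instance : Finite (Ideal (R p q)) := Finite.of_injective _ SetLike.coe_injective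

lemma card_minLeft (hpq : p ≠ q) (hdvd : p ∣ ordMod p q) (J : Idx p q) :
    Nat.card (MinLeft p q J.1) = ∑ k ∈ Finset.range p, p ^ (k * (ordMod p q / p)) := by
  obtain ⟨J, hJ, hJ0⟩ := J
  obtain ⟨e, he⟩ := exists_isIdentity hpq hJ
  let _ : Fintype (MinLeft p q J) := Fintype.ofFinite _
  -- Count the nonzero fixed elements of the block by the minimal left ideal they generate.
  have h1 : Nat.card (FixedNeZero J) =
      Nat.card (MinLeft p q J) * (p ^ (ordMod p q / p) - 1) := by
    rw [← Nat.card_congr (Equiv.sigmaFiberEquiv (he.toMinLeft hJ)), Nat.card_sigma,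
      Finset.sum_congr rfl fun I _ => he.card_fiber hpq hdvd hJ hJ0 I, Finset.sum_const,
      smul_eq_mul, Finset.card_univ, Nat.card_eq_fintype_card]
  have ht : 1 < p ^ (ordMod p q / p) :=
    Nat.one_lt_pow (Nat.div_pos (Nat.le_of_dvd (ordMod_pos hpq) hdvd)
      (Fact.out : p.Prime).pos).ne' (Fact.out : p.Prime).one_lt
  refine Nat.eq_of_mul_eq_mul_right (Nat.sub_pos_of_lt ht) ?_
  rw [← h1, he.card_fixedNeZero hpq hJ hJ0]
  have h2 := geom_sum_mul_add (p ^ (ordMod p q / p) - 1) p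
  rw [Nat.sub_add_cancel ht.le, ← pow_mul, Nat.div_mul_cancel hdvd] at h2
  simp only [← pow_mul, mul_comm (ordMod p q / p)] at h2
  omega

end MinimalLeftIdeals

/-! ### Low-weight words in translation-invariant codes -/

section Counting

open Real

/-- A linear code of dimension `k` is determined by at most `k` coordinates. -/
lemma exists_information_set {Γ F : Type*} [Finite Γ] [Field F] (C : Submodule F (Γ → F)) :
    ∃ A : Finset Γ, A.card ≤ Module.finrank F C ∧ ∀ f ∈ C, (∀ a ∈ A, f a = 0) → f = 0 := by
  classical
  induction h : Module.finrank F C using Nat.strong_induction_on generalizing C with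
  | _ d ih =>
    by_cases hC : C = ⊥
    · exact ⟨∅, by simp, fun f hf _ => by simpa [hC] using hf⟩
    · obtain ⟨f, hf, hf0⟩ := (Submodule.ne_bot_iff _).1 hC
      obtain ⟨x, hx⟩ := Function.ne_iff.1 hf0
      let C' := C ⊓ LinearMap.ker (LinearMap.proj (R := F) (φ := fun _ : Γ => F) x)
      have hlt : C' < C := lt_of_le_of_ne inf_le_left fun h => hx (by
        rw [← h] at hf
        exact hf.2)
      have hd := Submodule.finrank_lt_finrank_of_lt hlt
      obtain ⟨A, hA, hA'⟩ := ih _ (h ▸ hd) C' rfl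
      refine ⟨insert x A, (Finset.card_insert_le _ _).trans (by omega), fun f hf hfA => ?_⟩
      exact hA' f ⟨hf, hfA x (Finset.mem_insert_self _ _)⟩
        fun a ha => hfA a (Finset.mem_insert_of_mem ha)

/-- The probability of the symbol `c` when zero has probability `1 - δ` and the nonzero symbols are
equally likely. -/
noncomputable def symbolProb (F : Type*) [Zero F] (δ : ℝ) (c : F) : ℝ :=
  open Classical in if c = 0 then 1 - δ else δ / ((Nat.card F : ℝ) - 1)

variable {Γ F : Type*} [Group Γ] [Fintype Γ] [Field F] [Fintype F] {δ : ℝ}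

lemma one_lt_natCard_field : (1 : ℝ) < Nat.card F := by
  exact_mod_cast Finite.one_lt_card

lemma sum_symbolProb : ∑ c : F, symbolProb F δ c = 1 := by
  classical
  have h : ∀ c : F, symbolProb F δ c =
      δ / ((Nat.card F : ℝ) - 1) + if c = 0 then 1 - δ - δ / ((Nat.card F : ℝ) - 1) else 0 := by
    intro c
    by_cases hc : c = 0 <;> simp [symbolProb, hc]
  have h1 : (Nat.card F : ℝ) - 1 ≠ 0 := (sub_pos.2 one_lt_natCard_field).ne'
  rw [Finset.sum_congr rfl fun c _ => h c, Finset.sum_add_distrib, Finset.sum_ite_eq' Finset.univ,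
    if_pos (Finset.mem_univ _), Finset.sum_const, Finset.card_univ, nsmul_eq_mul,
    ← Nat.card_eq_fintype_card]
  field_simp
  ring

lemma one_sub_pos (hδ' : δ ≤ ((Nat.card F : ℝ) - 1) / Nat.card F) : 0 < 1 - δ := by
  have h := one_lt_natCard_field (F := F)
  have : ((Nat.card F : ℝ) - 1) / Nat.card F < 1 := by rw [div_lt_one (by linarith)]; linarith
  linarith

lemma div_le_one_sub (hδ' : δ ≤ ((Nat.card F : ℝ) - 1) / Nat.card F) :
    δ / ((Nat.card F : ℝ) - 1) ≤ 1 - δ := by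
  have h := one_lt_natCard_field (F := F)
  rw [le_div_iff₀ (by linarith)] at hδ'
  rw [div_le_iff₀ (by linarith)]
  nlinarith

lemma symbolProb_pos (hδ : 0 < δ) (hδ' : δ ≤ ((Nat.card F : ℝ) - 1) / Nat.card F) (c : F) :
    0 < symbolProb F δ c := by
  unfold symbolProb
  split_ifs
  · exact one_sub_pos hδ'
  · exact div_pos hδ (sub_pos.2 one_lt_natCard_field)

/-- A word with a proportion of at most `δ` nonzero symbols has probability at least
`exp (|Γ| (1 - δ) log (1 - δ) + |Γ| δ log (δ / (|F| - 1)))`. -/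
lemma le_log_prod_symbolProb (hδ : 0 < δ)
    (hδ' : δ ≤ ((Nat.card F : ℝ) - 1) / Nat.card F) (f : Γ → F)
    (hf : (Set.ncard {x | f x ≠ 0} : ℝ) ≤ δ * Nat.card Γ) :
    Nat.card Γ * ((1 - δ) * log (1 - δ) + δ * log (δ / ((Nat.card F : ℝ) - 1))) ≤
      log (∏ x, symbolProb F δ (f x)) := by
  classical
  have h1 : log (δ / ((Nat.card F : ℝ) - 1)) ≤ log (1 - δ) :=
    log_le_log (div_pos hδ (sub_pos.2 one_lt_natCard_field)) (div_le_one_sub hδ')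
  have h2 : ∀ x, log (symbolProb F δ (f x)) = log (1 - δ) +
      if f x ≠ 0 then log (δ / ((Nat.card F : ℝ) - 1)) - log (1 - δ) else 0 := by
    intro x
    by_cases hx : f x = 0 <;> simp [symbolProb, hx]
  have h3 : Set.ncard {x | f x ≠ 0} = (Finset.univ.filter fun x => f x ≠ 0).card := by
    rw [← Set.ncard_coe_finset]
    simp
  rw [log_prod fun x _ => (symbolProb_pos hδ hδ' _).ne', Finset.sum_congr rfl fun x _ => h2 x,
    Finset.sum_add_distrib, ← Finset.sum_filter, Finset.sum_const, Finset.sum_const,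
    Finset.card_univ, nsmul_eq_mul, nsmul_eq_mul, ← Nat.card_eq_fintype_card, ← h3]
  nlinarith

/-- The number of words with a proportion of at most `δ` nonzero symbols in a
translation-invariant code of dimension at most `k`.

Every translate of an information set `A` is again one, so that the probabilities
`∏ a ∈ A, symbolProb (f (g * a))` of the codewords `f` sum to at most one for each `g`. By the
inequality between the arithmetic and geometric means, the average over `g` of the probability of a
word is at least the `|A| / |Γ|`-th power of the probability of the whole word. -/
theorem ncard_lowWeight_mul_le (hδ : 0 < δ)
    (hδ' : δ ≤ ((Nat.card F : ℝ) - 1) / Nat.card F) (C : Submodule F (Γ → F))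
    (hC : ∀ f ∈ C, ∀ g : Γ, (fun x => f (g * x)) ∈ C) {k : ℕ} (hk : Module.finrank F C ≤ k) :
    (Set.ncard {f | f ∈ C ∧ (Set.ncard {x | f x ≠ 0} : ℝ) ≤ δ * Nat.card Γ} : ℝ) *
      exp (k * ((1 - δ) * log (1 - δ) + δ * log (δ / ((Nat.card F : ℝ) - 1)))) ≤ 1 := by
  classical
  set L := (1 - δ) * log (1 - δ) + δ * log (δ / ((Nat.card F : ℝ) - 1)) with hL
  obtain ⟨A, hAk, hA⟩ := exists_information_set C
  set B : Finset (Γ → F) := Finset.univ.filter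
    fun f => f ∈ C ∧ (Set.ncard {x | f x ≠ 0} : ℝ) ≤ δ * Nat.card Γ with hB
  have hBcard : Set.ncard {f | f ∈ C ∧ (Set.ncard {x | f x ≠ 0} : ℝ) ≤ δ * Nat.card Γ} =
      B.card := by
    rw [← Set.ncard_coe_finset, hB]
    simp
  rw [hBcard]
  have hn : (0 : ℝ) < Nat.card Γ := by exact_mod_cast Nat.card_pos
  have hδ1 := one_sub_pos hδ'
  have hL0 : L ≤ 0 := by
    have h1 : log (1 - δ) ≤ 0 := log_nonpos hδ1.le (by linarith)
    have h2 : log (δ / ((Nat.card F : ℝ) - 1)) ≤ 0 :=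
      log_nonpos (div_pos hδ (sub_pos.2 one_lt_natCard_field)).le
        ((div_le_one_sub hδ').trans (by linarith))
    rw [hL]
    nlinarith
  let W : (Γ → F) → Γ → ℝ := fun f g => ∏ a : A, symbolProb F δ (f (g * a))
  have hW : ∀ f g, 0 < W f g := fun f g => Finset.prod_pos fun a _ => symbolProb_pos hδ hδ' _
  have hsum : ∀ g, ∑ f ∈ B, W f g ≤ 1 := by
    intro g
    -- The translate `g * A` is again an information set.
    have hinj : Set.InjOn (fun (f : Γ → F) (a : A) => f (g * a)) B := by
      intro f hf f' hf' h
      have h0 := hA _ (C.sub_mem (hC f (Finset.mem_filter.1 hf).2.1 g)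
        (hC f' (Finset.mem_filter.1 hf').2.1 g)) fun a ha => by
          simpa [sub_eq_zero] using congrFun h ⟨a, ha⟩
      funext x
      have := congrFun h0 (g⁻¹ * x)
      simpa [sub_eq_zero] using this
    calc ∑ f ∈ B, W f g
        = ∑ h ∈ B.image fun (f : Γ → F) (a : A) => f (g * a), ∏ a, symbolProb F δ (h a) :=
          (Finset.sum_image (f := fun h : A → F => ∏ a, symbolProb F δ (h a)) hinj).symm
      _ ≤ ∑ h : A → F, ∏ a, symbolProb F δ (h a) :=
          Finset.sum_le_sum_of_subset_of_nonneg (Finset.subset_univ _) fun h _ _ =>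
            Finset.prod_nonneg fun a _ => (symbolProb_pos hδ hδ' _).le
      _ = 1 := by
          rw [← Fintype.prod_sum fun (_ : A) c => symbolProb F δ c]
          simp [sum_symbolProb]
  have hmean : ∀ f ∈ B, exp (k * L) ≤ ∑ g, (Nat.card Γ : ℝ)⁻¹ * W f g := by
    intro f hf
    -- For fixed `a`, the element `g * a` runs through the whole group.
    have hprod : ∏ g, W f g = (∏ x, symbolProb F δ (f x)) ^ A.card := by
      rw [Finset.prod_comm]
      rw [Finset.prod_congr rfl fun (a : A) _ =>
        Fintype.prod_equiv (Equiv.mulRight (a : Γ)) (fun g => symbolProb F δ (f (g * a)))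
          (fun x => symbolProb F δ (f x)) fun _ => rfl]
      simp
    have hgm := geom_mean_le_arith_mean_weighted Finset.univ (fun _ : Γ => (Nat.card Γ : ℝ)⁻¹)
      (W f) (fun _ _ => by positivity) (by simp) fun g _ => (hW f g).le
    refine le_trans ?_ hgm
    have hpos : 0 < ∏ x, symbolProb F δ (f x) :=
      Finset.prod_pos fun x _ => symbolProb_pos hδ hδ' _
    rw [Real.finsetProd_rpow _ _ fun g _ => (hW f g).le, hprod,
      rpow_def_of_pos (pow_pos hpos _), log_pow, exp_le_exp]
    have h1 := le_log_prod_symbolProb hδ hδ' f (Finset.mem_filter.1 hf).2.2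
    have h2 : (k : ℝ) * L ≤ A.card * L :=
      mul_le_mul_of_nonpos_right (by exact_mod_cast hAk.trans hk) hL0
    refine h2.trans ?_
    rw [mul_assoc]
    refine mul_le_mul_of_nonneg_left ?_ (Nat.cast_nonneg _)
    rwa [← div_eq_mul_inv, le_div_iff₀ hn, mul_comm]
  calc (B.card : ℝ) * exp (k * L) = ∑ f ∈ B, exp (k * L) := by simp
    _ ≤ ∑ f ∈ B, ∑ g, (Nat.card Γ : ℝ)⁻¹ * W f g := Finset.sum_le_sum hmean
    _ = ∑ g : Γ, (Nat.card Γ : ℝ)⁻¹ * ∑ f ∈ B, W f g := by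
        rw [Finset.sum_comm]
        exact Finset.sum_congr rfl fun g _ => (Finset.mul_sum _ _ _).symm
    _ ≤ ∑ g : Γ, (Nat.card Γ : ℝ)⁻¹ * 1 :=
        Finset.sum_le_sum fun g _ => mul_le_mul_of_nonneg_left (hsum g) (by positivity)
    _ = 1 := by simp

end Counting

/-! ### Decomposition of codewords into blocks -/

section Decomposition

variable {p q : ℕ} [Fact p.Prime] [Fact q.Prime]

instance : Finite (Ideal (Q p q)) := Finite.of_injective _ SetLike.coe_injective

noncomputable instance : Fintype (Idx p q) := Fintype.ofFinite _

lemma sumβ_mul_sumβ : sumβ p q * sumβ p q = (q : ZMod p) • sumβ p q := by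
  nth_rw 1 [sumβ]
  rw [Finset.sum_mul, Finset.sum_congr rfl fun i _ => βQ_pow_mul βQ_mul_sumβ i]
  simp [Nat.cast_smul_eq_nsmul]

/-- There is a nontrivial block, so that the codes are nonzero: a minimal ideal contained in
`(β - 1)` differs from `Q₀`. -/
lemma nonempty_idx (hpq : p ≠ q) (hdvd : p ∣ ordMod p q) : Nonempty (Idx p q) := by
  have h0 : βQ p q - 1 ≠ 0 := by
    intro h
    rw [sub_eq_zero, βQ, ← map_one (MonoidAlgebra.of (ZMod p) (N p q))] at h
    exact β_ne_one hpq hdvd (congrArg Subtype.val (MonoidAlgebra.of_injective h))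
  obtain h | ⟨J, hJ, hle⟩ := eq_bot_or_exists_atom_le (Ideal.span {βQ p q - 1})
  · exact absurd (Ideal.span_singleton_eq_bot.1 h) h0
  · refine ⟨⟨J, hJ, ?_⟩⟩
    rintro rfl
    rw [Q₀_eq] at hle hJ
    obtain ⟨v, hv⟩ := Ideal.mem_span_singleton'.1 (hle (Ideal.subset_span rfl))
    have h1 : sumβ p q * sumβ p q = 0 := by
      nth_rw 1 [← hv]
      rw [mul_assoc, sub_one_mul, βQ_mul_sumβ, sub_self, mul_zero]
    rw [sumβ_mul_sumβ, smul_eq_zero, or_iff_right (cast_q_ne_zero hpq)] at h1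
    exact hJ.1 (Ideal.span_singleton_eq_bot.2 h1)

variable {e : Idx p q → Q p q}

lemma mul_eq_zero_of_ne (he : ∀ J, IsIdentity J.1 (e J)) {J J' : Idx p q} (h : J ≠ J') :
    e J * e J' = 0 := by
  have hd := J.2.1.disjoint_of_ne J'.2.1 (fun h' => h (Subtype.ext h'))
  exact Submodule.disjoint_def.1 hd _ (J.1.mul_mem_right _ (he J).1) (J'.1.mul_mem_left _ (he J').1)

/-- The identities of the minimal ideals are orthogonal idempotents in an algebra of dimension at
most `q`. -/
lemma card_idx_le (hpq : p ≠ q) : Fintype.card (Idx p q) ≤ q := by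
  choose e he using fun J : Idx p q => exists_isIdentity hpq J.2.1
  have hli : LinearIndependent (ZMod p) e := by
    rw [Fintype.linearIndependent_iff]
    intro g hg J
    have h := congrArg (· * e J) hg
    simp only [Finset.sum_mul, zero_mul, smul_mul_assoc] at h
    rw [Finset.sum_eq_single_of_mem J (Finset.mem_univ _) fun J' _ hJ' => by
      rw [mul_eq_zero_of_ne he hJ', smul_zero], (he J).2 _ (he J).1] at h
    exact (smul_eq_zero.1 h).resolve_right ((he J).ne_zero J.2.1)
  refine hli.fintype_card_le_finrank.trans ?_
  let _ : Fintype (N p q) := Fintype.ofFinite _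
  rw [(MonoidAlgebra.coeffLinearEquiv (ZMod p)).finrank_eq, Module.finrank_finsupp_self,
    ← Nat.card_eq_fintype_card, Nat.card_zpowers]
  exact orderOf_le_of_pow_eq_one (Fact.out : q.Prime).pos β_pow

lemma code_decomposition (he : ∀ J, IsIdentity J.1 (e J)) (c : Choice p q) {x : R p q}
    (hx : x ∈ code c) :
    (∀ J, x * incl p q (e J) ∈ (c J).1) ∧ ∑ J, x * incl p q (e J) = x := by
  have horth : ∀ J, ∀ x ∈ (c J).1, ∀ J', J' ≠ J → x * incl p q (e J') = 0 := fun J x hx J' h => by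
    rw [← (he J).mem_block_iff.1 ((c J).2.2 x hx), mul_assoc, ← map_mul,
      mul_eq_zero_of_ne he h.symm, map_zero, mul_zero]
  refine Submodule.iSup_induction (fun J => (c J).1) (motive := fun x =>
    (∀ J, x * incl p q (e J) ∈ (c J).1) ∧ ∑ J, x * incl p q (e J) = x) hx ?_ ?_ ?_
  · intro J x hx
    have hxe := (he J).mem_block_iff.1 ((c J).2.2 x hx)
    refine ⟨fun J' => ?_, ?_⟩
    · by_cases h : J' = J
      · subst h
        rwa [hxe]
      · rw [horth J x hx J' h]
        exact zero_mem _
    · rw [Finset.sum_eq_single_of_mem J (Finset.mem_univ _) fun J' _ h => horth J x hx J' h, hxe]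
  · simp
  · intro x y hx hy
    refine ⟨fun J => ?_, ?_⟩
    · rw [add_mul]
      exact add_mem (hx.1 J) (hy.1 J)
    · simp only [add_mul]
      rw [Finset.sum_add_distrib, hx.2, hy.2]

/-- The sum of the blocks indexed by `S`, as a subspace of `𝔽_p G`. -/
noncomputable def blocks (S : Finset (Idx p q)) : Submodule (ZMod p) (R p q) :=
  ⨆ J ∈ S, block p q J.1

lemma elt_mul_mem_blocks (he : ∀ J, IsIdentity J.1 (e J)) (S : Finset (Idx p q)) {x : R p q}
    (hx : x ∈ blocks S) (g : G p q) : elt g * x ∈ blocks S := by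
  suffices h : blocks S ≤ (blocks S).comap (LinearMap.mulLeft (ZMod p) (elt g)) from h hx
  refine iSup₂_le fun J hJ y hy => ?_
  exact Submodule.mem_iSup_of_mem J (Submodule.mem_iSup_of_mem hJ ((he J).mul_mem_block _ hy))

lemma finrank_blocks_le (hpq : p ≠ q) (S : Finset (Idx p q)) :
    Module.finrank (ZMod p) (blocks S) ≤ S.card * (p * ordMod p q) := by
  refine (finrank_iSup_le_sum _ S).trans (Finset.sum_le_card_nsmul _ _ _ fun J _ => ?_)
  obtain ⟨e, he⟩ := exists_isIdentity hpq J.2.1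
  exact he.finrank_block_le hpq J.2.1 J.2.2

open Real in
/-- The bound on low-weight words, for left-invariant subspaces of the group algebra and in terms
of the entropy function. -/
lemma ncard_lowWeight_le {δ : ℝ} (hδ : 0 < δ) (hδ' : δ ≤ ((p : ℝ) - 1) / p)
    (C : Submodule (ZMod p) (R p q)) (hC : ∀ x ∈ C, ∀ g : G p q, elt g * x ∈ C) {k : ℕ}
    (hk : Module.finrank (ZMod p) C ≤ k) :
    (Set.ncard {x | x ∈ C ∧ (Set.ncard {g | x.coeff g ≠ 0} : ℝ) ≤ δ * Nat.card (G p q)} : ℝ) ≤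
      (p : ℝ) ^ (k * entropy p δ) := by
  let _ : Fintype (G p q) := Fintype.ofFinite _
  let Φ : R p q ≃ₗ[ZMod p] (G p q → ZMod p) := (MonoidAlgebra.coeffLinearEquiv (ZMod p)).trans
    (Finsupp.linearEquivFunOnFinite (ZMod p) (ZMod p) (G p q))
  have hΦ : ∀ x g, Φ x g = x.coeff g := fun _ _ => rfl
  have hp1 : (1 : ℝ) < p := by exact_mod_cast (Fact.out : p.Prime).one_lt
  have hpcard : (Nat.card (ZMod p) : ℝ) = p := by rw [Nat.card_zmod]
  have key := ncard_lowWeight_mul_le (F := ZMod p) hδ (by rwa [hpcard])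
    (C.map Φ.toLinearMap) (k := k) (by
      rintro _ ⟨x, hx, rfl⟩ g
      refine ⟨elt g⁻¹ * x, hC x hx _, funext fun h => ?_⟩
      change (elt g⁻¹ * x).coeff h = x.coeff (g * h)
      rw [coeff_elt_mul, inv_inv]) (by
      rwa [show Module.finrank (ZMod p) (C.map Φ.toLinearMap) = Module.finrank (ZMod p) C from
        LinearEquiv.finrank_map_eq Φ C])
  have himage : {f | f ∈ C.map Φ.toLinearMap ∧
      (Set.ncard {x | f x ≠ 0} : ℝ) ≤ δ * Nat.card (G p q)} =
      Φ '' {x | x ∈ C ∧ (Set.ncard {g | x.coeff g ≠ 0} : ℝ) ≤ δ * Nat.card (G p q)} := by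
    ext f
    constructor
    · rintro ⟨⟨x, hx, rfl⟩, h⟩
      exact ⟨x, ⟨hx, h⟩, rfl⟩
    · rintro ⟨x, ⟨hx, h⟩, rfl⟩
      exact ⟨⟨x, hx, rfl⟩, h⟩
  have hexp : exp (k * ((1 - δ) * log (1 - δ) + δ * log (δ / ((p : ℝ) - 1)))) =
      ((p : ℝ) ^ (k * entropy p δ))⁻¹ := by
    have hlog : log p ≠ 0 := (log_pos hp1).ne'
    rw [rpow_def_of_pos (by linarith), ← exp_neg, entropy, logb, logb]
    congr 1
    field_simp
    ring
  rw [himage, Set.ncard_image_of_injective _ Φ.injective, hpcard, hexp,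
    ← div_eq_mul_inv, div_le_one (by positivity)] at key
  exact key

lemma minLeft_eq_of_mem {J : Ideal (Q p q)} {I I' : MinLeft p q J} {x : R p q} (hx : x ∈ I.1)
    (hx' : x ∈ I'.1) (hx0 : x ≠ 0) : I = I' := by
  by_contra h
  have hd := I.2.1.disjoint_of_ne I'.2.1 (fun h' => h (Subtype.ext h'))
  exact hx0 (Submodule.disjoint_def.1 hd x hx hx')

/-- A code containing a word with nonzero components in the blocks of `S` is determined in these
blocks. -/
lemma ncard_choice_mul_le (hpq : p ≠ q) (hdvd : p ∣ ordMod p q) (S : Finset (Idx p q))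
    (v : Idx p q → R p q) (hv : ∀ J ∈ S, v J ≠ 0) :
    Set.ncard {c : Choice p q | ∀ J ∈ S, v J ∈ (c J).1} *
      (p ^ ((p - 1) * (ordMod p q / p))) ^ S.card ≤ Nat.card (Choice p q) := by
  classical
  let _ : ∀ J : Idx p q, Fintype (MinLeft p q J.1) := fun _ => Fintype.ofFinite _
  let T : ∀ J : Idx p q, Finset (MinLeft p q J.1) :=
    fun J => if J ∈ S then Finset.univ.filter fun I => v J ∈ I.1 else Finset.univ
  have hT : {c : Choice p q | ∀ J ∈ S, v J ∈ (c J).1} = Fintype.piFinset T := by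
    ext c
    simp only [Set.mem_ofPred_eq, Finset.mem_coe, Fintype.mem_piFinset, T]
    refine forall_congr' fun J => ?_
    by_cases h : J ∈ S <;> simp [h]
  have hprod : (p ^ ((p - 1) * (ordMod p q / p))) ^ S.card =
      ∏ J : Idx p q, if J ∈ S then p ^ ((p - 1) * (ordMod p q / p)) else 1 := by
    rw [Finset.prod_ite_mem, Finset.univ_inter, Finset.prod_const]
  rw [hT, Set.ncard_coe_finset, Fintype.card_piFinset, hprod, ← Finset.prod_mul_distrib,
    Nat.card_pi]
  refine Finset.prod_le_prod' fun J _ => ?_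
  by_cases h : J ∈ S
  · simp only [T, h, if_true]
    have h1 : (Finset.univ.filter fun I : MinLeft p q J.1 => v J ∈ I.1).card ≤ 1 := by
      refine Finset.card_le_one.2 fun I hI I' hI' => ?_
      exact minLeft_eq_of_mem (Finset.mem_filter.1 hI).2 (Finset.mem_filter.1 hI').2 (hv J h)
    refine (Nat.mul_le_mul_right _ h1).trans ?_
    rw [one_mul, card_minLeft hpq hdvd]
    exact Finset.single_le_sum (f := fun k => p ^ (k * (ordMod p q / p)))
      (fun _ _ => Nat.zero_le _)
      (Finset.mem_range.2 (Nat.sub_lt (Fact.out : p.Prime).pos one_pos))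
  · simp [T, h, Finset.card_univ]

/-- A code of small minimum distance contains a nonzero word of small weight. -/
lemma exists_lowWeight (hpq : p ≠ q) (hdvd : p ∣ ordMod p q) {δ : ℝ} (c : Choice p q)
    (h : relMinDist (code c) < δ) :
    ∃ x ∈ code c, x ≠ 0 ∧ (Set.ncard {g | x.coeff g ≠ 0} : ℝ) ≤ δ * Nat.card (G p q) := by
  obtain ⟨J⟩ := nonempty_idx hpq hdvd
  obtain ⟨y, hy, hy0⟩ := (Submodule.ne_bot_iff _).1 (c J).2.1.1
  have hne : {d | ∃ x ∈ code c, ∃ y ∈ code c, x ≠ y ∧ hdist x y = d}.Nonempty :=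
    ⟨_, y, Submodule.mem_iSup_of_mem J hy, 0, zero_mem _, hy0, rfl⟩
  obtain ⟨x, hx, y, hy, hxy, hd⟩ := Nat.sInf_mem hne
  refine ⟨x - y, sub_mem hx hy, sub_ne_zero.2 hxy, ?_⟩
  have hset : {g | (x - y).coeff g ≠ 0} = {g | x.coeff g ≠ y.coeff g} := by
    ext g
    simp [sub_ne_zero]
  have hn : (0 : ℝ) < Nat.card (G p q) := by exact_mod_cast Nat.card_pos
  rw [relMinDist, div_lt_iff₀ hn] at h
  rw [hset]
  change (hdist x y : ℝ) ≤ _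
  rw [hd]
  exact h.le

lemma one_add_pow_sub_one_le {a : ℝ} {l n : ℕ} (ha : 0 ≤ a) (hl : l ≤ n) (hn : n * a ≤ 1) :
    (1 + a) ^ l - 1 ≤ 2 * n * a := by
  have h0 : 0 ≤ n * a := mul_nonneg (Nat.cast_nonneg _) ha
  have h1 : (1 + a) ^ l ≤ Real.exp (n * a) := by
    rw [mul_comm, Real.exp_mul, Real.rpow_natCast]
    calc (1 + a) ^ l ≤ (1 + a) ^ n := pow_le_pow_right₀ (by linarith) hl
      _ ≤ Real.exp a ^ n := pow_le_pow_left₀ (by linarith) (by linarith [Real.add_one_le_exp a]) _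
  have h2 := (abs_le.1 (Real.abs_exp_sub_one_sub_id_le (abs_le.2 ⟨by linarith, hn⟩))).2
  nlinarith

end Decomposition

/-! ### The union bound -/

section UnionBound

variable {p q : ℕ} [Fact p.Prime] [Fact q.Prime]

/-- The union bound: a word whose nonzero components lie in the blocks of `S` belongs to a random
code with probability at most `p ^ (-|S| (p - 1) s / p)`, and the sum of these blocks has at most
`p ^ (|S| p s h(δ))` words of low weight. -/
lemma card_lowDist_le (hpq : p ≠ q) (hdvd : p ∣ ordMod p q) {δ : ℝ} (hδ : 0 < δ)
    (hδ' : δ ≤ ((p : ℝ) - 1) / p) :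
    (Nat.card {c : Choice p q | relMinDist (code c) < δ} : ℝ) ≤
      (∑ S ∈ Finset.univ.powerset.erase (∅ : Finset (Idx p q)),
        ((p : ℝ) ^ ((p * ordMod p q : ℕ) * entropy p δ) /
          (p : ℝ) ^ ((p - 1) * (ordMod p q / p))) ^ S.card) * Nat.card (Choice p q) := by
  classical
  choose e he using fun J : Idx p q => exists_isIdentity hpq J.2.1
  let _ : Fintype (Choice p q) := Fintype.ofFinite _
  let _ : Fintype (R p q) := Fintype.ofFinite _
  have hp0 : (0 : ℝ) < p := by exact_mod_cast (Fact.out : p.Prime).pos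
  let E : Finset (Idx p q) → R p q → Finset (Choice p q) := fun S x =>
    Finset.univ.filter fun c => ∀ J ∈ S, x * incl p q (e J) ∈ (c J).1
  let B : Finset (Idx p q) → Finset (R p q) := fun S => Finset.univ.filter fun x =>
    (x ∈ blocks S ∧ (Set.ncard {g | x.coeff g ≠ 0} : ℝ) ≤ δ * Nat.card (G p q)) ∧
      ∀ J ∈ S, x * incl p q (e J) ≠ 0
  have hcover : Finset.univ.filter (fun c : Choice p q => relMinDist (code c) < δ) ⊆
      (Finset.univ.powerset.erase (∅ : Finset (Idx p q))).biUnion fun S => (B S).biUnion (E S) := by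
    intro c hc
    obtain ⟨x, hx, hx0, hxw⟩ := exists_lowWeight hpq hdvd c (Finset.mem_filter.1 hc).2
    obtain ⟨h1, h2⟩ := code_decomposition he c hx
    let S := Finset.univ.filter fun J => x * incl p q (e J) ≠ 0
    have hS : ∑ J ∈ S, x * incl p q (e J) = x := by
      rw [Finset.sum_filter_ne_zero, h2]
    refine Finset.mem_biUnion.2 ⟨S, ?_, Finset.mem_biUnion.2 ⟨x, ?_, ?_⟩⟩
    · refine Finset.mem_erase.2 ⟨fun h => hx0 ?_, by simp⟩
      rw [← hS, h, Finset.sum_empty]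
    · refine Finset.mem_filter.2 ⟨Finset.mem_univ _, ⟨?_, hxw⟩, fun J hJ =>
        (Finset.mem_filter.1 hJ).2⟩
      rw [← hS]
      exact Submodule.sum_mem _ fun J hJ => Submodule.mem_iSup_of_mem J
        (Submodule.mem_iSup_of_mem hJ ((c J).2.2 _ (h1 J)))
    · exact Finset.mem_filter.2 ⟨Finset.mem_univ _, fun J _ => h1 J⟩
  have hB : ∀ S, ((B S).card : ℝ) ≤
      ((p : ℝ) ^ ((p * ordMod p q : ℕ) * entropy p δ)) ^ S.card := by
    intro S
    have h := ncard_lowWeight_le hδ hδ' (blocks S) (fun x hx g => elt_mul_mem_blocks he S hx g)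
      (finrank_blocks_le hpq S)
    rw [Nat.cast_mul, mul_assoc, mul_comm (S.card : ℝ), Real.rpow_mul hp0.le,
      Real.rpow_natCast] at h
    refine le_trans ?_ h
    rw [← Set.ncard_coe_finset]
    have hsub : (B S : Set (R p q)) ⊆ {x | x ∈ blocks S ∧
        (Set.ncard {g | x.coeff g ≠ 0} : ℝ) ≤ δ * Nat.card (G p q)} :=
      fun x hx => (Finset.mem_filter.1 hx).2.1
    exact_mod_cast Set.ncard_le_ncard hsub
  have hE : ∀ S, ∀ x ∈ B S, ((E S x).card : ℝ) ≤
      Nat.card (Choice p q) / ((p : ℝ) ^ ((p - 1) * (ordMod p q / p))) ^ S.card := by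
    intro S x hx
    rw [le_div_iff₀ (by positivity)]
    have h := ncard_choice_mul_le hpq hdvd S (fun J => x * incl p q (e J))
      (Finset.mem_filter.1 hx).2.2
    have h2 : Set.ncard {c : Choice p q | ∀ J ∈ S, x * incl p q (e J) ∈ (c J).1} =
        (E S x).card := by
      rw [← Set.ncard_coe_finset]
      simp [E]
    rw [h2] at h
    exact_mod_cast h
  have hcard : Nat.card {c : Choice p q | relMinDist (code c) < δ} =
      (Finset.univ.filter (fun c : Choice p q => relMinDist (code c) < δ)).card := by
    rw [Nat.card_coe_set_eq, ← Set.ncard_coe_finset]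
    simp
  rw [hcard, Finset.sum_mul]
  calc ((Finset.univ.filter (fun c : Choice p q => relMinDist (code c) < δ)).card : ℝ)
      ≤ ∑ S ∈ Finset.univ.powerset.erase (∅ : Finset (Idx p q)), ∑ x ∈ B S,
          ((E S x).card : ℝ) := by
        have h1 := (Finset.card_le_card hcover).trans Finset.card_biUnion_le
        have h2 := h1.trans (Finset.sum_le_sum fun S _ => Finset.card_biUnion_le)
        exact_mod_cast h2
    _ ≤ _ := Finset.sum_le_sum fun S _ => by
        refine (Finset.sum_le_card_nsmul _ _ _ (hE S)).trans ?_
        rw [nsmul_eq_mul, div_pow, div_mul_eq_mul_div, mul_div_assoc']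
        gcongr
        exact hB S

lemma sum_erase_empty_pow {ι : Type*} [Fintype ι] [DecidableEq (Finset ι)] (a : ℝ) :
    ∑ S ∈ Finset.univ.powerset.erase (∅ : Finset ι), a ^ S.card =
      (1 + a) ^ Fintype.card ι - 1 := by
  classical
  have h := Finset.sum_pow_mul_eq_add_pow a 1 (Finset.univ : Finset ι)
  simp only [one_pow, mul_one] at h
  rw [Finset.sum_erase_eq_sub (Finset.empty_mem_powerset _), h, Finset.card_univ,
    Finset.card_empty, pow_zero, add_comm]

end UnionBound

end GroupCode

open GroupCode in
theorem theorem3p6 (p q : ℕ) (hp : p.Prime) (hq : q.Prime) (hpq : p ≠ q)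
    (hdvd : p ∣ GroupCode.ordMod p q) :
    (∀ J : GroupCode.Idx p q,
      Nat.card (GroupCode.MinLeft p q J.1) =
        ∑ k ∈ Finset.range p, p ^ (k * (GroupCode.ordMod p q / p))) ∧
    ∀ δ : ℝ, 0 < δ → δ ≤ ((p : ℝ) - 1) / p →
      GroupCode.entropy p δ ≤
        ((p : ℝ) - 1) / (p : ℝ) ^ 2 - Real.logb p q / ((p : ℝ) * GroupCode.ordMod p q) →
      GroupCode.uniformProb (GroupCode.Choice p q)
          {c | GroupCode.relMinDist (GroupCode.code c) < δ} ≤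
        (p : ℝ) ^ (-((p : ℝ) * GroupCode.ordMod p q *
            (((p : ℝ) - 1) / (p : ℝ) ^ 2 - GroupCode.entropy p δ)) +
          (2 * (p : ℝ) + 1) * Real.logb p q) := by
  have : Fact p.Prime := ⟨hp⟩
  have : Fact q.Prime := ⟨hq⟩
  refine ⟨card_minLeft hpq hdvd, fun δ hδ hδ' hh => ?_⟩
  classical
  have hp1 : (1 : ℝ) < p := by exact_mod_cast hp.one_lt
  have hp0 : (0 : ℝ) < p := by linarith
  have hq2 : (2 : ℝ) ≤ q := by exact_mod_cast hq.two_le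
  have hs : (0 : ℝ) < ordMod p q := by exact_mod_cast ordMod_pos hpq
  have hlogq : (p : ℝ) ^ Real.logb p q = q := Real.rpow_logb hp0 hp1.ne' (by linarith)
  set X := (p : ℝ) * ordMod p q * (((p : ℝ) - 1) / (p : ℝ) ^ 2 - entropy p δ) with hX
  -- The ratio of the number of low-weight words to the number of minimal left ideals, per block.
  have ha : (p : ℝ) ^ ((p * ordMod p q : ℕ) * entropy p δ) /
      (p : ℝ) ^ ((p - 1) * (ordMod p q / p)) = (p : ℝ) ^ (-X) := by
    rw [← Real.rpow_natCast, ← Real.rpow_sub hp0]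
    congr 1
    rw [Nat.cast_mul, Nat.cast_mul, Nat.cast_div hdvd hp0.ne', Nat.cast_sub hp.one_le, hX]
    field_simp
    push_cast
    ring
  -- The hypothesis on the entropy says that this ratio is at most `1 / q`.
  have haq : (p : ℝ) ^ (-X) * q ≤ 1 := by
    have h1 : Real.logb p q ≤ X := by
      have h2 : Real.logb p q / ((p : ℝ) * ordMod p q) ≤
          ((p : ℝ) - 1) / (p : ℝ) ^ 2 - entropy p δ := by linarith
      rw [div_le_iff₀ (by positivity)] at h2
      rw [hX]
      linarith
    have h2 : (p : ℝ) ^ (-X) * q = (p : ℝ) ^ (-X + Real.logb p q) := by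
      rw [Real.rpow_add hp0, hlogq]
    rw [h2]
    exact Real.rpow_le_one_of_one_le_of_nonpos hp1.le (by linarith)
  have hbound := card_lowDist_le hpq hdvd hδ hδ'
  rw [ha, sum_erase_empty_pow] at hbound
  refine (div_le_of_le_mul₀ (Nat.cast_nonneg _) (Real.rpow_nonneg hp0.le _)
    (hbound.trans (mul_le_mul_of_nonneg_right ?_ (Nat.cast_nonneg _))))
  refine (one_add_pow_sub_one_le (by positivity) (card_idx_le hpq) (by linarith)).trans ?_
  -- The factor `2 q` of the union bound is at most `q ^ 2`, hence below `q ^ (2 p + 1)`.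
  have hqpow : (q : ℝ) ^ 2 ≤ (p : ℝ) ^ ((2 * (p : ℝ) + 1) * Real.logb p q) := by
    rw [mul_comm, Real.rpow_mul hp0.le, hlogq, ← Real.rpow_natCast]
    exact Real.rpow_le_rpow_of_exponent_le (by linarith) (by push_cast; linarith)
  rw [Real.rpow_add hp0, mul_comm]
  refine mul_le_mul_of_nonneg_left (le_trans ?_ hqpow) (by positivity)
  nlinarith
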